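/- Let $\mathcal G\rightrightarrows M$ be a (smooth, finite-dimensional, real) Lie groupoid with source and target maps $\mathsf s,\mathsf t:\mathcal G\to M$ and multiplication $m:\mathcal G^{(2)}=\{(g,h)\in\mathcal G\times\mathcal G\mid \mathsf s(g)=\mathsf t(h)\}\to\mathcal G$. For a manifold $N$, let $\Omega^k(N,TN)=\Gamma(\wedge^kT^*N\otimes TN)$ be the space of smooth vector-valued $k$-forms on $N$, viewed as maps $\oplus^kTN\to TN$. For $k\ge 0$, let $\oplus^kT\mathcal G\rightrightarrows\oplus^kTM$ be the groupoid whose source, target and multiplication are $T\mathsf s$, $T\mathsf t$ and $Tm$ applied componentwise, where $T(\mathcal G^{(2)})$ is identified with $\{(X,Y)\in T\mathcal G\times T\mathcal G\mid T\mathsf s(X)=T\mathsf t(Y)\}$; for $k=1$ it is the tangent groupoid $T\mathcal G\rightrightarrows TM$. A form $K\in\Omega^k(\mathcal G,T\mathcal G)$ is called multiplicative if there is $K_M\in\Omega^k(M,TM)$ such that $K:\oplus^kT\mathcal G\to T\mathcal G$ is a groupoid morphism over $K_M:\oplus^kTM\to TM$, i.e. the pair $(K,K_M)$ commutes with the source and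 target maps and preserves multiplication. (a) If $K\in\Omega^1(\mathcal G,T\mathcal G)$ is multiplicative, then its Nijenhuis tensor $N_K\in\Omega^2(\mathcal G,T\mathcal G)$, given on vector fields by $$N_K(X,Y)=[KX,KY]-K\big([KX,Y]+[X,KY]\big)+K^2[X,Y],$$ is multiplicative. (b) If $K\in\Omega^1(\mathcal G,T\mathcal G)$ is a multiplicative projection, i.e. multiplicative with $K\circ K=K$, then its curvature $R_K\in\Omega^2(\mathcal G,T\mathcal G)$, given on vector fields by $$R_K(X,Y)=K\big([(\mathrm{Id}-K)X,(\mathrm{Id}-K)Y]\big),$$ satisfies $R_K=K\circ N_K$ and is multiplicative. -/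

import Mathlib

open Bundle Manifold VectorField Set
open scoped Manifold ContDiff Topology

noncomputable section

/-! ### Vector-valued forms -/

/-- `VForm E N k` is the space `Ω^k(N, TN)` of smooth sections of the bundle of alternating
`k`-linear maps `TN × ⋯ × TN → TN`, where `N` is a smooth manifold modelled on `E`. -/
structure VForm (E : Type*) [NormedAddCommGroup E] [NormedSpace ℝ E]
    (N : Type*) [TopologicalSpace N] [ChartedSpace E N] [IsManifold 𝓘(ℝ, E) ∞ N] (k : ℕ) where
  /-- the alternating map on each tangent space -/
  toFun : ∀ x : N, TangentSpace 𝓘(ℝ, E) x [⋀^Fin k]→L[ℝ] TangentSpace 𝓘(ℝ, E) x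
  smooth : ContMDiff 𝓘(ℝ, E) (𝓘(ℝ, E).prod 𝓘(ℝ, E [⋀^Fin k]→L[ℝ] E)) ∞
    (fun x ↦ TotalSpace.mk' (E [⋀^Fin k]→L[ℝ] E)
      (E := fun x : N ↦ TangentSpace 𝓘(ℝ, E) x [⋀^Fin k]→L[ℝ] TangentSpace 𝓘(ℝ, E) x) x (toFun x))

namespace VForm

theorem contMDiffAt_alternating {E : Type*} [NormedAddCommGroup E] [NormedSpace ℝ E]
    [FiniteDimensional ℝ E] {N : Type*} [TopologicalSpace N] [ChartedSpace E N] {k : ℕ}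
    {f : N → E [⋀^Fin k]→L[ℝ] E} {x₀ : N}
    (h : ∀ m : Fin k → E, ContMDiffAt 𝓘(ℝ, E) 𝓘(ℝ, E) ∞ (fun x ↦ f x m) x₀) :
    ContMDiffAt 𝓘(ℝ, E) 𝓘(ℝ, E [⋀^Fin k]→L[ℝ] E) ∞ f x₀ := by
  let b := Module.finBasis ℝ E
  let L : (E [⋀^Fin k]→L[ℝ] E) →ₗ[ℝ] ((Fin k → Fin (Module.finrank ℝ E)) → E) :=
    { toFun := fun A j ↦ A fun i ↦ b (j i)
      map_add' := fun _ _ ↦ rfl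
      map_smul' := fun _ _ ↦ rfl }
  have hL : Function.Injective L := fun A B hAB ↦
    ContinuousAlternatingMap.toAlternatingMap_injective
      (b.ext_alternating fun j _ ↦ congrFun hAB j)
  obtain ⟨g, hg⟩ := L.exists_leftInverse_of_injective (LinearMap.ker_eq_bot.2 hL)
  have hfg : f = fun x ↦ g.toContinuousLinearMap (L (f x)) :=
    funext fun x ↦ (LinearMap.congr_fun hg (f x)).symm
  rw [hfg]
  exact g.toContinuousLinearMap.contDiff.contMDiff.contMDiffAt.comp x₀
    (contMDiffAt_pi_space.2 fun j ↦ h _)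

section

variable {E : Type*} [NormedAddCommGroup E] [NormedSpace ℝ E]
  {N : Type*} [TopologicalSpace N] [ChartedSpace E N] [IsManifold 𝓘(ℝ, E) ∞ N]

/-- A vector-valued `1`-form, seen as an endomorphism of the tangent bundle. -/
def endo (K : VForm E N 1) (x : N) : TangentSpace 𝓘(ℝ, E) x →L[ℝ] TangentSpace 𝓘(ℝ, E) x :=
  (ContinuousAlternatingMap.ofSubsingleton ℝ (TangentSpace 𝓘(ℝ, E) x)
    (TangentSpace 𝓘(ℝ, E) x) (0 : Fin 1)).symm (K.toFun x)

theorem endo_apply (K : VForm E N 1) (x : N) (v : TangentSpace 𝓘(ℝ, E) x) :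
    K.endo x v = K.toFun x (fun _ ↦ v) := rfl

/-- The action of a vector-valued `1`-form on vector fields. -/
def app (K : VForm E N 1) (X : ∀ x : N, TangentSpace 𝓘(ℝ, E) x) :
    ∀ x : N, TangentSpace 𝓘(ℝ, E) x := fun x ↦ K.endo x (X x)

theorem contMDiff_endo (K : VForm E N 1) :
    ContMDiff 𝓘(ℝ, E) (𝓘(ℝ, E).prod 𝓘(ℝ, E →L[ℝ] E)) ∞
      (fun x ↦ TotalSpace.mk' (E →L[ℝ] E)
        (E := fun x : N ↦ TangentSpace 𝓘(ℝ, E) x →L[ℝ] TangentSpace 𝓘(ℝ, E) x) x (K.endo x)) := by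
  intro x₀
  have h := (contMDiffAt_section x₀).1 (K.smooth x₀)
  rw [contMDiffAt_hom_bundle]
  refine ⟨contMDiffAt_id, ?_⟩
  exact (ContinuousAlternatingMap.ofSubsingletonLIE (𝕜 := ℝ) (E := E) (F := E)
    (0 : Fin 1)).symm.contDiff.contMDiff.contMDiffAt.comp x₀ h

theorem contMDiffAt_app (K : VForm E N 1) {X : ∀ x : N, TangentSpace 𝓘(ℝ, E) x} {x : N}
    (hX : ContMDiffAt 𝓘(ℝ, E) (𝓘(ℝ, E).prod 𝓘(ℝ, E)) ∞ (fun y ↦ TotalSpace.mk' E y (X y)) x) :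
    ContMDiffAt 𝓘(ℝ, E) (𝓘(ℝ, E).prod 𝓘(ℝ, E)) ∞ (fun y ↦ TotalSpace.mk' E y (K.app X y)) x :=
  (K.contMDiff_endo x).clm_bundle_apply hX

theorem mdifferentiableAt_app (K : VForm E N 1) {X : ∀ x : N, TangentSpace 𝓘(ℝ, E) x} {x : N}
    (hX : MDiffAt (T% X) x) : MDiffAt (T% (K.app X)) x :=
  ((K.contMDiff_endo x).mdifferentiableAt (by simp)).clm_bundle_apply hX

theorem app_add (K : VForm E N 1) (X Y : ∀ x : N, TangentSpace 𝓘(ℝ, E) x) :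
    K.app (X + Y) = K.app X + K.app Y := funext fun x ↦ (K.endo x).map_add _ _

theorem app_sub (K : VForm E N 1) (X Y : ∀ x : N, TangentSpace 𝓘(ℝ, E) x) :
    K.app (X - Y) = K.app X - K.app Y := funext fun x ↦ (K.endo x).map_sub _ _

theorem app_smul (K : VForm E N 1) (f : N → ℝ) (X : ∀ x : N, TangentSpace 𝓘(ℝ, E) x) :
    K.app (f • X) = f • K.app X := funext fun x ↦ (K.endo x).map_smul _ _

/-- The alternating map attached to a bilinear map that vanishes on the diagonal. -/
def altOfBilin {x : N}
    (B : TangentSpace 𝓘(ℝ, E) x →L[ℝ] TangentSpace 𝓘(ℝ, E) x →L[ℝ] TangentSpace 𝓘(ℝ, E) x)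
    (hB : ∀ v, B v v = 0) :
    TangentSpace 𝓘(ℝ, E) x [⋀^Fin 2]→L[ℝ] TangentSpace 𝓘(ℝ, E) x where
  toFun m := B (m 0) (m 1)
  map_update_add' := by
    intro _ m i u v
    fin_cases i <;> simp [Function.update]
  map_update_smul' := by
    intro _ m i c v
    fin_cases i <;> simp [Function.update]
  map_eq_zero_of_eq' := by
    intro m i j h hij
    fin_cases i <;> fin_cases j <;> simp_all
  cont := by
    have h : Continuous fun m : Fin 2 → E ↦ (show E →L[ℝ] E →L[ℝ] E from B) (m 0) (m 1) := by
      fun_prop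
    exact h

variable [FiniteDimensional ℝ E]

/-- A field of alternating maps that sends smooth vector fields to smooth vector fields is
smooth. -/
theorem contMDiff_of_apply {k : ℕ}
    (A : ∀ x : N, TangentSpace 𝓘(ℝ, E) x [⋀^Fin k]→L[ℝ] TangentSpace 𝓘(ℝ, E) x)
    (h : ∀ (X : Fin k → ∀ x : N, TangentSpace 𝓘(ℝ, E) x) (x₀ : N),
      (∀ i, CMDiffAt ∞ (T% (X i)) x₀) → CMDiffAt ∞ (T% (fun x ↦ A x fun i ↦ X i x)) x₀) :
    ContMDiff 𝓘(ℝ, E) (𝓘(ℝ, E).prod 𝓘(ℝ, E [⋀^Fin k]→L[ℝ] E)) ∞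
      (fun x ↦ TotalSpace.mk' (E [⋀^Fin k]→L[ℝ] E)
        (E := fun x : N ↦ TangentSpace 𝓘(ℝ, E) x [⋀^Fin k]→L[ℝ] TangentSpace 𝓘(ℝ, E) x)
        x (A x)) := by
  intro x₀
  rw [contMDiffAt_section]
  refine contMDiffAt_alternating fun m ↦ ?_
  let e := trivializationAt E (TangentSpace 𝓘(ℝ, E) : N → Type _) x₀
  have he : x₀ ∈ e.baseSet := FiberBundle.mem_baseSet_trivializationAt' x₀
  have hX : ∀ i, CMDiffAt ∞ (T% (fun x ↦ e.symmL ℝ x (m i))) x₀ := fun i ↦ by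
    rw [contMDiffAt_section]
    refine (contMDiffAt_const (c := m i)).congr_of_eventuallyEq ?_
    filter_upwards [e.open_baseSet.mem_nhds he] with x hx
    exact (e.continuousLinearMapAt_apply_of_mem (R := ℝ) hx _).symm.trans
      (e.continuousLinearMapAt_symmL (R := ℝ) hx (m i))
  have := (contMDiffAt_section x₀).1 (h _ x₀ hX)
  refine this.congr_of_eventuallyEq ?_
  filter_upwards [e.open_baseSet.mem_nhds he] with x hx
  exact e.continuousLinearMapAt_apply_of_mem (R := ℝ) hx _

/-- A bilinear operation on vector fields that is tensorial in both arguments, alternating and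
preserves smoothness is (the action on vector fields of) a vector-valued `2`-form. -/
def ofTensorial
    (Φ : (∀ x : N, TangentSpace 𝓘(ℝ, E) x) → (∀ x : N, TangentSpace 𝓘(ℝ, E) x) →
      ∀ x : N, TangentSpace 𝓘(ℝ, E) x)
    (h₁ : ∀ x (Y : ∀ x : N, TangentSpace 𝓘(ℝ, E) x), MDiffAt (T% Y) x →
      TensorialAt 𝓘(ℝ, E) E (fun X ↦ Φ X Y x) x)
    (h₂ : ∀ x (X : ∀ x : N, TangentSpace 𝓘(ℝ, E) x), MDiffAt (T% X) x →
      TensorialAt 𝓘(ℝ, E) E (fun Y ↦ Φ X Y x) x)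
    (h₀ : ∀ X x, Φ X X x = 0)
    (hs : ∀ (X Y : ∀ x : N, TangentSpace 𝓘(ℝ, E) x) (x : N), CMDiffAt ∞ (T% X) x →
      CMDiffAt ∞ (T% Y) x → CMDiffAt ∞ (T% (Φ X Y)) x) :
    VForm E N 2 where
  toFun x := altOfBilin (TensorialAt.mkHom₂ (fun X Y ↦ Φ X Y x) x (h₁ x) (h₂ x))
    (fun v ↦ h₀ _ x)
  smooth := contMDiff_of_apply _ fun X x₀ hX ↦ by
    refine (hs (X 0) (X 1) x₀ (hX 0) (hX 1)).congr_of_eventuallyEq ?_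
    have h : ∀ i, ∀ᶠ x in 𝓝 x₀, MDiffAt (T% (X i)) x := fun i ↦ by
      have h1 := (hX i).of_le (m := 1) (by simp)
      filter_upwards [(contMDiffAt_iff_contMDiffAt_nhds (by simp)).1 h1] with x hx
      exact hx.mdifferentiableAt one_ne_zero
    filter_upwards [h 0, h 1] with x h0 h1
    exact congrArg (TotalSpace.mk' E x) (TensorialAt.mkHom₂_apply (h₁ x) (h₂ x) h0 h1)

theorem ofTensorial_apply
    (Φ : (∀ x : N, TangentSpace 𝓘(ℝ, E) x) → (∀ x : N, TangentSpace 𝓘(ℝ, E) x) →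
      ∀ x : N, TangentSpace 𝓘(ℝ, E) x) (h₁ h₂ h₀ hs)
    {X Y : ∀ x : N, TangentSpace 𝓘(ℝ, E) x} {x : N} (hX : MDiffAt (T% X) x)
    (hY : MDiffAt (T% Y) x) :
    (ofTensorial Φ h₁ h₂ h₀ hs).toFun x ![X x, Y x] = Φ X Y x :=
  TensorialAt.mkHom₂_apply (h₁ x) (h₂ x) hX hY

theorem contMDiffAt_bracket {X Y : ∀ x : N, TangentSpace 𝓘(ℝ, E) x} {x : N}
    (hX : CMDiffAt ∞ (T% X) x) (hY : CMDiffAt ∞ (T% Y) x) :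
    CMDiffAt ∞ (T% (mlieBracket 𝓘(ℝ, E) X Y)) x := by
  have : IsManifold 𝓘(ℝ, E) (((⊤ : ℕ∞) : ℕ∞ω) + 1) N := by simpa
  have : IsManifold 𝓘(ℝ, E) (minSmoothness ℝ 2) N := by simp; infer_instance
  exact ContMDiffAt.mlieBracket_vectorField (m := ⊤) (n := ⊤) hX hY (by simp)

/-- The Nijenhuis tensor of `K`, i.e. the vector-valued `2`-form `N_K` with
`N_K(X, Y) = [KX, KY] - K([KX, Y] + [X, KY]) + K²[X, Y]` for all vector fields `X`, `Y`. -/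
def nijenhuis (K : VForm E N 1) : VForm E N 2 :=
  ofTensorial
    (fun X Y ↦ mlieBracket 𝓘(ℝ, E) (K.app X) (K.app Y)
      - K.app (mlieBracket 𝓘(ℝ, E) (K.app X) Y + mlieBracket 𝓘(ℝ, E) X (K.app Y))
      + K.app (K.app (mlieBracket 𝓘(ℝ, E) X Y)))
    (fun x Y hY ↦
      { smul := fun {f X} hf hX ↦ by
          have hKX := K.mdifferentiableAt_app hX
          simp only [app_smul, app, Pi.add_apply, Pi.sub_apply]
          rw [mlieBracket_smul_left hf hKX, mlieBracket_smul_left hf hKX,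
            mlieBracket_smul_left hf hX, mlieBracket_smul_left hf hX]
          simp [app]
          module
        add := fun {X X'} hX hX' ↦ by
          have hKX := K.mdifferentiableAt_app hX
          have hKX' := K.mdifferentiableAt_app hX'
          simp only [app_add, app, Pi.add_apply, Pi.sub_apply]
          rw [mlieBracket_add_left hKX hKX', mlieBracket_add_left hKX hKX',
            mlieBracket_add_left hX hX', mlieBracket_add_left hX hX']
          simp
          module })
    (fun x X hX ↦
      { smul := fun {f Y} hf hY ↦ by
          have hKY := K.mdifferentiableAt_app hY
          simp only [app_smul, app, Pi.add_apply, Pi.sub_apply]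
          rw [mlieBracket_smul_right hf hKY, mlieBracket_smul_right hf hKY,
            mlieBracket_smul_right hf hY, mlieBracket_smul_right hf hY]
          simp [app]
          module
        add := fun {Y Y'} hY hY' ↦ by
          have hKY := K.mdifferentiableAt_app hY
          have hKY' := K.mdifferentiableAt_app hY'
          simp only [app_add, app, Pi.add_apply, Pi.sub_apply]
          rw [mlieBracket_add_right hKY hKY', mlieBracket_add_right hKY hKY',
            mlieBracket_add_right hY hY', mlieBracket_add_right hY hY']
          simp
          module })
    (fun X x ↦ by
      have h := mlieBracket_swap_apply (I := 𝓘(ℝ, E)) (V := X) (W := K.app X) (x := x)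
      simp [app] at h ⊢
      simp [h])
    (fun X Y x hX hY ↦ by
      have hKX := K.contMDiffAt_app hX
      have hKY := K.contMDiffAt_app hY
      exact ((contMDiffAt_bracket hKX hKY).sub_section (K.contMDiffAt_app
        ((contMDiffAt_bracket hKX hY).add_section (contMDiffAt_bracket hX hKY)))).add_section
        (K.contMDiffAt_app (K.contMDiffAt_app (contMDiffAt_bracket hX hY))))

theorem nijenhuis_apply (K : VForm E N 1) {X Y : ∀ x : N, TangentSpace 𝓘(ℝ, E) x} {x : N}
    (hX : MDiffAt (T% X) x) (hY : MDiffAt (T% Y) x) :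
    K.nijenhuis.toFun x ![X x, Y x] =
      mlieBracket 𝓘(ℝ, E) (K.app X) (K.app Y) x
        - K.endo x (mlieBracket 𝓘(ℝ, E) (K.app X) Y x + mlieBracket 𝓘(ℝ, E) X (K.app Y) x)
        + K.endo x (K.endo x (mlieBracket 𝓘(ℝ, E) X Y x)) :=
  ofTensorial_apply _ _ _ _ _ hX hY

/-- `K` is a projection: `K ∘ K = K`. -/
def IsProjection (K : VForm E N 1) : Prop :=
  ∀ x, (K.endo x).comp (K.endo x) = K.endo x

/-- The curvature of a projection `K`, i.e. the vector-valued `2`-form `R_K` with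
`R_K(X, Y) = K [(Id - K) X, (Id - K) Y]` for all vector fields `X`, `Y`. -/
def curvature (K : VForm E N 1) (hK : K.IsProjection) : VForm E N 2 :=
  ofTensorial
    (fun X Y ↦ K.app (mlieBracket 𝓘(ℝ, E) (X - K.app X) (Y - K.app Y)))
    (fun x Y hY ↦
      { smul := fun {f X} hf hX ↦ by
          have hPX := mdifferentiableAt_sub_section hX (K.mdifferentiableAt_app hX)
          have h := DFunLike.congr_fun (hK x) (X x)
          simp only [app_smul, ← smul_sub]
          rw [app, mlieBracket_smul_left hf hPX]
          simp_all [app]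
        add := fun {X X'} hX hX' ↦ by
          have hPX := mdifferentiableAt_sub_section hX (K.mdifferentiableAt_app hX)
          have hPX' := mdifferentiableAt_sub_section hX' (K.mdifferentiableAt_app hX')
          simp only [app_add, add_sub_add_comm]
          rw [app, mlieBracket_add_left hPX hPX']
          simp [app] })
    (fun x X hX ↦
      { smul := fun {f Y} hf hY ↦ by
          have hPY := mdifferentiableAt_sub_section hY (K.mdifferentiableAt_app hY)
          have h := DFunLike.congr_fun (hK x) (Y x)
          simp only [app_smul, ← smul_sub]
          rw [app, mlieBracket_smul_right hf hPY]
          simp_all [app]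
        add := fun {Y Y'} hY hY' ↦ by
          have hPY := mdifferentiableAt_sub_section hY (K.mdifferentiableAt_app hY)
          have hPY' := mdifferentiableAt_sub_section hY' (K.mdifferentiableAt_app hY')
          simp only [app_add, add_sub_add_comm]
          rw [app, mlieBracket_add_right hPY hPY']
          simp [app] })
    (fun X x ↦ by simp [app])
    (fun X Y x hX hY ↦ K.contMDiffAt_app (contMDiffAt_bracket
      (hX.sub_section (K.contMDiffAt_app hX)) (hY.sub_section (K.contMDiffAt_app hY))))

theorem curvature_apply (K : VForm E N 1) (hK : K.IsProjection)
    {X Y : ∀ x : N, TangentSpace 𝓘(ℝ, E) x} {x : N}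
    (hX : MDiffAt (T% X) x) (hY : MDiffAt (T% Y) x) :
    (K.curvature hK).toFun x ![X x, Y x] =
      K.endo x (mlieBracket 𝓘(ℝ, E) (X - K.app X) (Y - K.app Y) x) :=
  ofTensorial_apply _ _ _ _ _ hX hY

end

/-- A vector-valued `k`-form on `N`, seen as a map `⊕^k TN → TN`. -/
def toMap {E : Type*} [NormedAddCommGroup E] [NormedSpace ℝ E]
    {N : Type*} [TopologicalSpace N] [ChartedSpace E N] [IsManifold 𝓘(ℝ, E) ∞ N] {k : ℕ}
    (K : VForm E N k) (p : Σ x : N, Fin k → TangentSpace 𝓘(ℝ, E) x) : TangentBundle 𝓘(ℝ, E) N :=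
  ⟨p.1, K.toFun p.1 p.2⟩

end VForm

/-! ### Lie groupoids -/

/-- The source, target and multiplication maps of a groupoid with arrows `A` and objects `O`.
Only the values of `mul` on composable pairs, `source a = target b`, are meaningful. -/
structure GroupoidMaps (A O : Type*) where
  /-- the source map -/
  source : A → O
  /-- the target map -/
  target : A → O
  /-- the multiplication, a junk value on pairs that are not composable -/
  mul : A → A → A

/-- The pair `(F, f)` commutes with source and target maps and preserves multiplication. -/
structure GroupoidMaps.IsMorphism {A O B P : Type*} (𝒢 : GroupoidMaps A O)
    (ℋ : GroupoidMaps B P) (F : A → B) (f : O → P) : Prop where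
  source_comm : ∀ a, ℋ.source (F a) = f (𝒢.source a)
  target_comm : ∀ a, ℋ.target (F a) = f (𝒢.target a)
  map_mul : ∀ a b, 𝒢.source a = 𝒢.target b → F (𝒢.mul a b) = ℋ.mul (F a) (F b)

/-- A Lie groupoid `G ⇉ M`. The space of composable arrows is an embedded submanifold of `G × G`
because `source` and `target` are submersions; a map is smooth on an embedded submanifold if and
only if it is smooth on it as a subset of the ambient manifold, in the sense of `ContMDiffOn`. -/
structure LieGroupoid (E : Type*) [NormedAddCommGroup E] [NormedSpace ℝ E]
    (G : Type*) [TopologicalSpace G] [ChartedSpace E G]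
    (E' : Type*) [NormedAddCommGroup E'] [NormedSpace ℝ E']
    (M : Type*) [TopologicalSpace M] [ChartedSpace E' M] extends GroupoidMaps G M where
  /-- the unit map -/
  one : M → G
  /-- the inversion -/
  inv : G → G
  source_mul : ∀ g h, source g = target h → source (mul g h) = source h
  target_mul : ∀ g h, source g = target h → target (mul g h) = target g
  mul_assoc : ∀ g h k, source g = target h → source h = target k →
    mul (mul g h) k = mul g (mul h k)
  source_one : ∀ x, source (one x) = x
  target_one : ∀ x, target (one x) = x
  mul_one : ∀ g, mul g (one (source g)) = g
  one_mul : ∀ g, mul (one (target g)) g = g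
  source_inv : ∀ g, source (inv g) = target g
  target_inv : ∀ g, target (inv g) = source g
  mul_inv : ∀ g, mul g (inv g) = one (target g)
  inv_mul : ∀ g, mul (inv g) g = one (source g)
  submersion_source : IsSubmersion 𝓘(ℝ, E) 𝓘(ℝ, E') ∞ source
  submersion_target : IsSubmersion 𝓘(ℝ, E) 𝓘(ℝ, E') ∞ target
  smooth_mul : ContMDiffOn (𝓘(ℝ, E).prod 𝓘(ℝ, E)) 𝓘(ℝ, E) ∞ (fun p : G × G ↦ mul p.1 p.2)
    {p | source p.1 = target p.2}
  smooth_one : ContMDiff 𝓘(ℝ, E') 𝓘(ℝ, E) ∞ one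
  smooth_inv : ContMDiff 𝓘(ℝ, E) 𝓘(ℝ, E) ∞ inv

namespace LieGroupoid

variable {E : Type*} [NormedAddCommGroup E] [NormedSpace ℝ E]
  {G : Type*} [TopologicalSpace G] [ChartedSpace E G]
  {E' : Type*} [NormedAddCommGroup E'] [NormedSpace ℝ E']
  {M : Type*} [TopologicalSpace M] [ChartedSpace E' M]

/-- The set of composable arrows. -/
def composable (𝒢 : LieGroupoid E G E' M) : Set (G × G) := {p | 𝒢.source p.1 = 𝒢.target p.2}

/-- The tangent map `Tm (X, Y)` of the multiplication, for `X ∈ T_g G` and `Y ∈ T_h G`. When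
`(g, h)` is composable and `Ts X = Tt Y`, so that `(X, Y)` is tangent to the submanifold of
composable arrows, the value does not depend on the derivative within this set that
`mfderivWithin` selects; other pairs `(X, Y)` are not used. -/
def tangentMul (𝒢 : LieGroupoid E G E' M) (g h : G) (X : TangentSpace 𝓘(ℝ, E) g)
    (Y : TangentSpace 𝓘(ℝ, E) h) : TangentSpace 𝓘(ℝ, E) (𝒢.mul g h) :=
  mfderivWithin (𝓘(ℝ, E).prod 𝓘(ℝ, E)) 𝓘(ℝ, E) (fun p : G × G ↦ 𝒢.mul p.1 p.2) 𝒢.composable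
    (g, h) (X, Y)

/-- The tangent groupoid `TG ⇉ TM`. -/
def tangent (𝒢 : LieGroupoid E G E' M) :
    GroupoidMaps (TangentBundle 𝓘(ℝ, E) G) (TangentBundle 𝓘(ℝ, E') M) where
  source := tangentMap 𝓘(ℝ, E) 𝓘(ℝ, E') 𝒢.source
  target := tangentMap 𝓘(ℝ, E) 𝓘(ℝ, E') 𝒢.target
  mul v w := ⟨𝒢.mul v.1 w.1, 𝒢.tangentMul v.1 w.1 v.2 w.2⟩

/-- The groupoid `⊕^k TG ⇉ ⊕^k TM`, with structure maps defined componentwise. -/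
def tangentSum (𝒢 : LieGroupoid E G E' M) (k : ℕ) :
    GroupoidMaps (Σ g : G, Fin k → TangentSpace 𝓘(ℝ, E) g)
      (Σ x : M, Fin k → TangentSpace 𝓘(ℝ, E') x) where
  source p := ⟨𝒢.source p.1, fun i ↦ mfderiv 𝓘(ℝ, E) 𝓘(ℝ, E') 𝒢.source p.1 (p.2 i)⟩
  target p := ⟨𝒢.target p.1, fun i ↦ mfderiv 𝓘(ℝ, E) 𝓘(ℝ, E') 𝒢.target p.1 (p.2 i)⟩
  mul p q := ⟨𝒢.mul p.1 q.1, fun i ↦ 𝒢.tangentMul p.1 q.1 (p.2 i) (q.2 i)⟩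

/-- A vector-valued form `K` on the arrows is multiplicative if, for some vector-valued form `K_M`
on the objects, `K : ⊕^k TG → TG` is a groupoid morphism over `K_M : ⊕^k TM → TM`. -/
def IsMultiplicative [IsManifold 𝓘(ℝ, E) ∞ G] [IsManifold 𝓘(ℝ, E') ∞ M]
    (𝒢 : LieGroupoid E G E' M) {k : ℕ} (K : VForm E G k) : Prop :=
  ∃ K_M : VForm E' M k, (𝒢.tangentSum k).IsMorphism 𝒢.tangent K.toMap K_M.toMap

end LieGroupoid

end

/-! The Nijenhuis tensor respects relatedness: if Tf ∘ K = K' ∘ Tf, then Tf carries N_K to N_{K'}.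
Multiplicativity of K says that K is related to K_M along source and target, and that K × K on
composable arrows is related to K along multiplication. Here K × K preserves tangent vectors to
composable pairs because both projections meet the same K_M. Part (a) is this principle applied to
the three structure maps.

Source and target are covered by `nijenhuis_related`. For multiplication, the space of composable
pairs is replaced by a local parametrization (φ₁, φ₂) by a vector space S, on which K × K becomes a
field A of endomorphisms (`exists_composable_parametrization`). Then `nijenhuis_map`, along φ₁, φ₂
and their product, expresses all three values of N_K through the single tensor N_A. It rests on
`nijenhuisModel_map`: differentiate the relation once, and the second derivatives of the map cancel
by symmetry.

For (b), expanding brackets with K² = K gives R_K = K ∘ N_K (`curvature_eq_endo_nijenhuis`), and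
multiplicativity passes to this composite. The base form K_M is also a projection, because source is
a surjective submersion. -/

/-! ### Endomorphism fields on vector spaces, and regular level sets. -/

section Model

variable {F : Type*} [NormedAddCommGroup F] [NormedSpace ℝ F]
  {V : Type*} [NormedAddCommGroup V] [NormedSpace ℝ V]
  {W : Type*} [NormedAddCommGroup W] [NormedSpace ℝ W]

/-- The Nijenhuis tensor of a field `A` of endomorphisms of a vector space, evaluated at the point
`z` on constant vector fields `u` and `v`. -/
noncomputable def nijenhuisModel (A : F → F →L[ℝ] F) (z u v : F) : F :=
  fderiv ℝ A z (A z u) v - fderiv ℝ A z (A z v) u + A z (fderiv ℝ A z v u)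
    - A z (fderiv ℝ A z u v)

/-- The Nijenhuis tensors of two related fields of endomorphisms are related. -/
theorem nijenhuisModel_map {f : F → V} {A : F → F →L[ℝ] F} {B : V → V →L[ℝ] V} {z : F}
    (hf : ContDiffAt ℝ ∞ f z) (hA : DifferentiableAt ℝ A z) (hB : DifferentiableAt ℝ B (f z))
    (h : ∀ᶠ y in 𝓝 z, ∀ w, fderiv ℝ f y (A y w) = B (f y) (fderiv ℝ f y w)) (u v : F) :
    nijenhuisModel B (f z) (fderiv ℝ f z u) (fderiv ℝ f z v) =
      fderiv ℝ f z (nijenhuisModel A z u v) := by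
  have hf' : HasFDerivAt (fderiv ℝ f) (fderiv ℝ (fderiv ℝ f) z) z :=
    ((hf.fderiv_right (m := 1) (by norm_cast)).differentiableAt one_ne_zero).hasFDerivAt
  have hsymm : ∀ a b, fderiv ℝ (fderiv ℝ f) z a b = fderiv ℝ (fderiv ℝ f) z b a :=
    hf.isSymmSndFDerivAt (by simp; exact WithTop.coe_le_coe.2 le_top)
  have hBf : HasFDerivAt (fun y ↦ B (f y)) ((fderiv ℝ B (f z)).comp (fderiv ℝ f z)) z :=
    hB.hasFDerivAt.comp z (hf.differentiableAt (by simp)).hasFDerivAt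
  -- The relation `h` on a constant vector b, differentiated at z in the direction a.
  have key : ∀ a b, fderiv ℝ (fderiv ℝ f) z a (A z b) + fderiv ℝ f z (fderiv ℝ A z a b) =
      fderiv ℝ B (f z) (fderiv ℝ f z a) (fderiv ℝ f z b)
        + B (f z) (fderiv ℝ (fderiv ℝ f) z a b) := by
    intro a b
    have h1 := hf'.clm_apply (hA.hasFDerivAt.clm_apply (hasFDerivAt_const b z))
    have h2 := hBf.clm_apply (hf'.clm_apply (hasFDerivAt_const b z))
    have h3 := (h1.congr_of_eventuallyEq (by
      filter_upwards [h] with y hy using (hy b).symm)).unique h2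
    have := congrArg (fun L ↦ L a) h3
    simp at this
    rw [add_comm, this, add_comm]
  have hz := h.self_of_nhds
  -- In the combination below the terms D²f(Au, Av), B D²f(Au, v), B D²f(Av, u) and B² D²f(u, v)
  -- each occur twice, with opposite signs once D²f is symmetrized. What survives is the claim.
  have e1 := key (A z u) v
  have e2 := key (A z v) u
  have e3 := congrArg (B (f z)) (key v u)
  have e4 := congrArg (B (f z)) (key u v)
  have s1 := hsymm (A z u) (A z v)
  have s2 := hsymm (A z u) v
  have s3 := hsymm (A z v) u
  have s4 := hsymm u v
  simp only [map_add, hz] at e1 e2 e3 e4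
  simp only [nijenhuisModel, map_add, map_sub, hz]
  rw [s1] at e1
  rw [s2] at e1
  rw [s3] at e2
  rw [s4] at e4
  linear_combination (norm := module) (-1 : ℝ) • e1 + (1 : ℝ) • e2 + (-1 : ℝ) • e3 + (1 : ℝ) • e4

/-- The endomorphism `B₁ y.1 × B₂ y.2` of the product depends smoothly on `y`. -/
theorem contDiffAt_prodMap {B₁ B₂ : F → F →L[ℝ] F} {p : F × F} (h₁ : ContDiffAt ℝ ∞ B₁ p.1)
    (h₂ : ContDiffAt ℝ ∞ B₂ p.2) :
    ContDiffAt ℝ ∞ (fun y : F × F ↦ (B₁ y.1).prodMap (B₂ y.2)) p := by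
  have h₁' : ContDiffAt ℝ ∞ (fun y : F × F ↦ B₁ y.1) p := ContDiffAt.comp p h₁ contDiffAt_fst
  have h₂' : ContDiffAt ℝ ∞ (fun y : F × F ↦ B₂ y.2) p := ContDiffAt.comp p h₂ contDiffAt_snd
  have h : (fun y : F × F ↦ (B₁ y.1).prodMap (B₂ y.2)) = fun y ↦
      (ContinuousLinearMap.inl ℝ F F).comp ((B₁ y.1).comp (ContinuousLinearMap.fst ℝ F F)) +
      (ContinuousLinearMap.inr ℝ F F).comp ((B₂ y.2).comp (ContinuousLinearMap.snd ℝ F F)) := by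
    funext y
    ext <;> simp
  rw [h]
  exact (contDiffAt_const.clm_comp (h₁'.clm_comp contDiffAt_const)).add
    (contDiffAt_const.clm_comp (h₂'.clm_comp contDiffAt_const))

/-- A level set of a smooth map with surjective derivative at `p` has a smooth parametrization
`φ` near `p`, and the derivative of `φ` maps onto the kernel of the derivative of the map, with a
right inverse on this kernel given by the derivative of a smooth map `ρ`. -/
theorem exists_parametrization [FiniteDimensional ℝ V] [FiniteDimensional ℝ W] {f : V → W} {p : V}
    (hf : ContDiffAt ℝ ∞ f p) (hs : Function.Surjective (fderiv ℝ f p)) :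
    ∃ (S : Submodule ℝ V) (φ : S → V) (ρ : V → S), φ 0 = p ∧ ContDiffAt ℝ ∞ φ 0 ∧
      ContDiffAt ℝ ∞ ρ p ∧ (∀ᶠ z in 𝓝 0, f (φ z) = f p) ∧
      ∀ᶠ z in 𝓝 0, ∀ w, fderiv ℝ f (φ z) w = 0 → fderiv ℝ φ z (fderiv ℝ ρ (φ z) w) = w := by
  have : CompleteSpace V := FiniteDimensional.complete ℝ V
  have : CompleteSpace W := FiniteDimensional.complete ℝ W
  have hr : (fderiv ℝ f p).range = ⊤ := LinearMap.range_eq_top.2 hs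
  have hk : (fderiv ℝ f p).ker.ClosedComplemented :=
    Submodule.ClosedComplemented.of_finiteDimensional _
  -- This pairs f with ρ, the projection of y - p onto the kernel of f'(p). The pair Φ = (f, ρ) is a
  -- local diffeomorphism, and φ z = Φ⁻¹(f p, z).
  let d := HasStrictFDerivAt.implicitFunctionDataOfComplemented f (fderiv ℝ f p)
    (hf.hasStrictFDerivAt (by simp)) hr hk
  let Φ := d.toOpenPartialHomeomorph
  have hΦ : ∀ y, Φ y = (f y, d.rightFun y) := fun y ↦ rfl
  have hρ : ContDiff ℝ ∞ d.rightFun :=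
    (Classical.choose hk).contDiff.comp (contDiff_id.sub contDiff_const)
  have hp : p ∈ Φ.source := d.pt_mem_toOpenPartialHomeomorph_source
  have hρp : d.rightFun p = 0 := by simp [d]
  have hΦp : Φ p = (f p, 0) := by rw [hΦ, hρp]
  have ht : (f p, (0 : (fderiv ℝ f p).ker)) ∈ Φ.target := hΦp ▸ Φ.map_source hp
  have hsp : Φ.symm (f p, 0) = p := by rw [← hΦp, Φ.left_inv hp]
  have hΦs : ContDiffAt ℝ ∞ Φ.symm (f p, 0) :=
    Φ.contDiffAt_symm ht (by rw [hsp]; exact d.hasStrictFDerivAt.hasFDerivAt)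
      (by rw [hsp]; exact hf.prodMk hρ.contDiffAt)
  let ι : (fderiv ℝ f p).ker → W × (fderiv ℝ f p).ker := fun z ↦ (f p, z)
  have hι : ∀ z, HasFDerivAt ι (ContinuousLinearMap.inr ℝ W _) z :=
    fun z ↦ hasFDerivAt_prodMk_right (f p) z
  have hιc : ContDiff ℝ ∞ ι := contDiff_const.prodMk contDiff_id
  have hev : ∀ᶠ z in 𝓝 (0 : (fderiv ℝ f p).ker), ι z ∈ Φ.target :=
    hιc.continuous.continuousAt.eventually (Φ.open_target.mem_nhds ht)
  have hφ0 : Φ.symm (ι 0) = p := hsp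
  have hφc : ContDiffAt ℝ ∞ (fun z ↦ Φ.symm (ι z)) 0 := hΦs.comp 0 hιc.contDiffAt
  refine ⟨_, fun z ↦ Φ.symm (ι z), d.rightFun, hφ0, hφc, hρ.contDiffAt, ?_, ?_⟩
  · filter_upwards [hev] with z hz
    exact congrArg Prod.fst (Φ.right_inv hz)
  -- Only finite smoothness spreads from a point to a neighbourhood, hence the exponent 1.
  · have h1 : ∀ᶠ q in 𝓝 (f p, (0 : (fderiv ℝ f p).ker)), ContDiffAt ℝ 1 Φ.symm q :=
      (hΦs.of_le (by norm_cast)).eventually (by simp)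
    have h2 : ∀ᶠ y in 𝓝 p, ContDiffAt ℝ 1 f y := (hf.of_le (by norm_cast)).eventually (by simp)
    filter_upwards [hev, hιc.continuous.continuousAt.eventually h1,
      hφc.continuousAt.eventually (hφ0.symm ▸ h2)] with z hz hz1 hz2 w hw
    have d1 : HasFDerivAt Φ ((fderiv ℝ f (Φ.symm (ι z))).prod
        (fderiv ℝ d.rightFun (Φ.symm (ι z)))) (Φ.symm (ι z)) :=
      (hz2.differentiableAt one_ne_zero).hasFDerivAt.prodMk
        (hρ.contDiffAt.differentiableAt (by simp)).hasFDerivAt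
    have d2 := (hz1.differentiableAt one_ne_zero).hasFDerivAt
    have d3 : fderiv ℝ (fun z ↦ Φ.symm (ι z)) z = _ := (d2.comp z (hι z)).fderiv
    have hsrc := Φ.map_target hz
    -- Differentiating Φ⁻¹ ∘ Φ = id: if Df w = 0 then DΦ w = (0, Dρ w), so the identity on w reads
    -- Dφ (Dρ w) = w.
    have d4 := HasFDerivAt.comp (Φ.symm (ι z)) (by rw [Φ.right_inv hz]; exact d2) d1
    have d5 := (d4.congr_of_eventuallyEq (by
      filter_upwards [Φ.open_source.mem_nhds hsrc] with y hy
      exact (Φ.left_inv hy).symm)).unique (hasFDerivAt_id _)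
    have d6 := congrArg (fun L ↦ L w) d5
    simp only [ContinuousLinearMap.comp_apply, ContinuousLinearMap.prod_apply, hw] at d6
    rw [d3]
    exact d6

end Model

/-! ### Tangent vectors, derivatives and Lie brackets in preferred charts. -/

section Coordinates

variable {E : Type*} [NormedAddCommGroup E] [NormedSpace ℝ E]
  {N : Type*} [TopologicalSpace N] [ChartedSpace E N]
  {F : Type*} [NormedAddCommGroup F] [NormedSpace ℝ F]

theorem contDiffAt_chartAt_comp {ψ : F → N} {x₀ : N} {z : F}
    (hψ : ContMDiffAt 𝓘(ℝ, F) 𝓘(ℝ, E) ∞ ψ z) (hz : ψ z = x₀) :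
    ContDiffAt ℝ ∞ (fun y ↦ extChartAt 𝓘(ℝ, E) x₀ (ψ y)) z := by
  subst hz
  exact (contMDiffAt_extChartAt.comp z hψ).contDiffAt

variable [IsManifold 𝓘(ℝ, E) ∞ N]

/-- The differential at `x` of the preferred chart at `x₀`. -/
noncomputable abbrev tangentCoord (x₀ x : N) : TangentSpace 𝓘(ℝ, E) x →L[ℝ] E :=
  (trivializationAt E (TangentSpace 𝓘(ℝ, E) : N → Type _) x₀).continuousLinearMapAt ℝ x

/-- The inverse of the differential at `x` of the preferred chart at `x₀`. -/
noncomputable abbrev tangentCoordSymm (x₀ x : N) : E →L[ℝ] TangentSpace 𝓘(ℝ, E) x :=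
  (trivializationAt E (TangentSpace 𝓘(ℝ, E) : N → Type _) x₀).symmL ℝ x

theorem tangentCoord_tangentCoordSymm {x₀ x : N} (hx : x ∈ (chartAt E x₀).source) (v : E) :
    tangentCoord x₀ x (tangentCoordSymm x₀ x v) = v :=
  (trivializationAt E (TangentSpace 𝓘(ℝ, E) : N → Type _) x₀).continuousLinearMapAt_symmL
    (R := ℝ) hx v

theorem tangentCoordSymm_tangentCoord {x₀ x : N} (hx : x ∈ (chartAt E x₀).source)
    (v : TangentSpace 𝓘(ℝ, E) x) :
    tangentCoordSymm x₀ x (tangentCoord x₀ x v) = v :=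
  (trivializationAt E (TangentSpace 𝓘(ℝ, E) : N → Type _) x₀).symmL_continuousLinearMapAt
    (R := ℝ) hx v

theorem tangentCoord_injective {x₀ x : N} (hx : x ∈ (chartAt E x₀).source) :
    Function.Injective (tangentCoord (E := E) x₀ x) :=
  Function.LeftInverse.injective (tangentCoordSymm_tangentCoord hx)

/-- The vector field with constant coordinates `v` in the preferred chart is differentiable. -/
theorem mdifferentiableAt_tangentCoordSymm (x₀ : N) (v : E) :
    MDiffAt (T% (fun x ↦ tangentCoordSymm x₀ x v)) x₀ := by
  let e := trivializationAt E (TangentSpace 𝓘(ℝ, E) : N → Type _) x₀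
  have he : x₀ ∈ e.baseSet := FiberBundle.mem_baseSet_trivializationAt' x₀
  refine ContMDiffAt.mdifferentiableAt (n := ∞) ?_ (by simp)
  rw [contMDiffAt_section]
  refine (contMDiffAt_const (c := v)).congr_of_eventuallyEq ?_
  filter_upwards [e.open_baseSet.mem_nhds he] with x hx
  exact (e.continuousLinearMapAt_apply_of_mem (R := ℝ) hx _).symm.trans
    (e.continuousLinearMapAt_symmL (R := ℝ) hx v)

/-- Every tangent vector extends to a differentiable vector field. -/
theorem exists_mdifferentiableAt_eq {x : N} (v : TangentSpace 𝓘(ℝ, E) x) :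
    ∃ X : ∀ y : N, TangentSpace 𝓘(ℝ, E) y, MDiffAt (T% X) x ∧ X x = v :=
  ⟨fun y ↦ tangentCoordSymm x y (tangentCoord x x v),
    mdifferentiableAt_tangentCoordSymm x _, tangentCoordSymm_tangentCoord (mem_chart_source E x) v⟩

theorem hasMFDerivAt_chartAt {x₀ x : N} (hx : x ∈ (chartAt E x₀).source) :
    HasMFDerivAt 𝓘(ℝ, E) 𝓘(ℝ, E) (extChartAt 𝓘(ℝ, E) x₀) x (tangentCoord x₀ x) := by
  rw [tangentCoord, TangentBundle.continuousLinearMapAt_trivializationAt hx]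
  exact (mdifferentiableAt_extChartAt hx).hasMFDerivAt

theorem hasMFDerivAt_chartAt_symm {x₀ : N} {y : E} (hy : y ∈ (extChartAt 𝓘(ℝ, E) x₀).target) :
    HasMFDerivAt 𝓘(ℝ, E) 𝓘(ℝ, E) (extChartAt 𝓘(ℝ, E) x₀).symm y
      (tangentCoordSymm (E := E) x₀ ((extChartAt 𝓘(ℝ, E) x₀).symm y)) := by
  have hx : (extChartAt 𝓘(ℝ, E) x₀).symm y ∈ (chartAt E x₀).source := by
    simpa using (extChartAt 𝓘(ℝ, E) x₀).map_target hy
  have h := TangentBundle.symmL_trivializationAt (I := 𝓘(ℝ, E)) (𝕜 := ℝ) hx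
  rw [(extChartAt 𝓘(ℝ, E) x₀).right_inv hy] at h
  rw [tangentCoordSymm, h]
  have := (mdifferentiableWithinAt_extChartAt_symm (I := 𝓘(ℝ, E)) hy).hasMFDerivWithinAt
  simpa using this

theorem mfderiv_chartAt_symm_comp {x₀ : N} {φ : F → E} {z : F}
    (hz : φ z ∈ (extChartAt 𝓘(ℝ, E) x₀).target) (hφ : DifferentiableAt ℝ φ z) (w : F) :
    mfderiv 𝓘(ℝ, F) 𝓘(ℝ, E) (fun y ↦ (extChartAt 𝓘(ℝ, E) x₀).symm (φ y)) z w =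
      tangentCoordSymm x₀ ((extChartAt 𝓘(ℝ, E) x₀).symm (φ z)) (fderiv ℝ φ z w) :=
  congrArg (fun L ↦ L w)
    ((hasMFDerivAt_chartAt_symm hz).comp z hφ.hasFDerivAt.hasMFDerivAt).mfderiv

theorem mfderiv_chartAt_symm {x₀ : N} {y : E} (hy : y ∈ (extChartAt 𝓘(ℝ, E) x₀).target) (w : E) :
    mfderiv 𝓘(ℝ, E) 𝓘(ℝ, E) (extChartAt 𝓘(ℝ, E) x₀).symm y w =
      tangentCoordSymm x₀ ((extChartAt 𝓘(ℝ, E) x₀).symm y) w :=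
  congrArg (fun L ↦ L w) (hasMFDerivAt_chartAt_symm hy).mfderiv

theorem differentiableAt_chartAt_comp {ψ : F → N} {x₀ : N} {z : F}
    (hψ : MDifferentiableAt 𝓘(ℝ, F) 𝓘(ℝ, E) ψ z) (hz : ψ z ∈ (chartAt E x₀).source) :
    DifferentiableAt ℝ (fun y ↦ extChartAt 𝓘(ℝ, E) x₀ (ψ y)) z :=
  ((hasMFDerivAt_chartAt hz).mdifferentiableAt.comp z hψ).differentiableAt

/-- The derivative of a map into a manifold, read in a chart. -/
theorem fderiv_chartAt_comp {ψ : F → N} {x₀ : N} {z : F}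
    (hψ : MDifferentiableAt 𝓘(ℝ, F) 𝓘(ℝ, E) ψ z) (hz : ψ z ∈ (chartAt E x₀).source) (w : F) :
    fderiv ℝ (fun y ↦ extChartAt 𝓘(ℝ, E) x₀ (ψ y)) z w =
      tangentCoord x₀ (ψ z) (mfderiv 𝓘(ℝ, F) 𝓘(ℝ, E) ψ z w) := by
  let L : F →L[ℝ] E := (tangentCoord x₀ (ψ z)).comp (mfderiv 𝓘(ℝ, F) 𝓘(ℝ, E) ψ z)
  have h : HasFDerivAt (fun y ↦ extChartAt 𝓘(ℝ, E) x₀ (ψ y)) L z :=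
    ((hasMFDerivAt_chartAt hz).comp z hψ.hasMFDerivAt).hasFDerivAt
  exact congrArg (fun L : F →L[ℝ] E ↦ L w) h.fderiv

/-- Elements of tangent spaces at equal points that agree in the model space have the same
coordinates. -/
theorem tangentCoord_congr {x₀ x y : N} (hxy : x = y) {v : TangentSpace 𝓘(ℝ, E) x}
    {w : TangentSpace 𝓘(ℝ, E) y} (hvw : @Eq E v w) : tangentCoord x₀ x v = tangentCoord x₀ y w := by
  subst hxy
  exact congrArg _ hvw

theorem eventually_mdifferentiableAt {P : Type*} [TopologicalSpace P] [ChartedSpace F P]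
    [IsManifold 𝓘(ℝ, F) ∞ P] {ψ : P → N} {z : P} (hψ : ContMDiffAt 𝓘(ℝ, F) 𝓘(ℝ, E) ∞ ψ z) :
    ∀ᶠ y in 𝓝 z, MDifferentiableAt 𝓘(ℝ, F) 𝓘(ℝ, E) ψ y := by
  filter_upwards [(contMDiffAt_iff_contMDiffAt_nhds (by simp)).1 (hψ.of_le (m := 1) (by simp))]
    with y hy using hy.mdifferentiableAt one_ne_zero

/-- The Lie bracket of two vector fields, computed in the preferred chart. -/
theorem mlieBracket_eq_lieBracket {X Y : ∀ x : N, TangentSpace 𝓘(ℝ, E) x} {x₀ : N} {v w : E → E}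
    (hX : ∀ᶠ x in 𝓝 x₀, X x = tangentCoordSymm x₀ x (v (extChartAt 𝓘(ℝ, E) x₀ x)))
    (hY : ∀ᶠ x in 𝓝 x₀, Y x = tangentCoordSymm x₀ x (w (extChartAt 𝓘(ℝ, E) x₀ x))) :
    mlieBracket 𝓘(ℝ, E) X Y x₀ =
      tangentCoordSymm x₀ x₀ (lieBracket ℝ v w (extChartAt 𝓘(ℝ, E) x₀ x₀)) := by
  have aux : ∀ {X : ∀ x : N, TangentSpace 𝓘(ℝ, E) x} {v : E → E},
      (∀ᶠ x in 𝓝 x₀, X x = tangentCoordSymm x₀ x (v (extChartAt 𝓘(ℝ, E) x₀ x))) →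
      mpullbackWithin 𝓘(ℝ, E) 𝓘(ℝ, E) (extChartAt 𝓘(ℝ, E) x₀).symm X (range 𝓘(ℝ, E))
        =ᶠ[𝓝 (extChartAt 𝓘(ℝ, E) x₀ x₀)] v := by
    intro X v hX
    have h1 := (continuousAt_extChartAt_symm (I := 𝓘(ℝ, E)) x₀).eventually
      (by rw [extChartAt_to_inv]; exact hX)
    filter_upwards [h1, extChartAt_target_mem_nhds (I := 𝓘(ℝ, E)) x₀] with y hy hyt
    rw [mpullbackWithin_apply, hy, (extChartAt 𝓘(ℝ, E) x₀).right_inv hyt]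
    have h2 := (hasMFDerivAt_chartAt_symm hyt).mfderiv
    have h3 := isInvertible_mfderivWithin_extChartAt_symm (I := 𝓘(ℝ, E)) hyt
    have h4 : mfderivWithin 𝓘(ℝ, E) 𝓘(ℝ, E) (extChartAt 𝓘(ℝ, E) x₀).symm (range 𝓘(ℝ, E)) y
      = tangentCoordSymm (E := E) x₀ ((extChartAt 𝓘(ℝ, E) x₀).symm y) := by
      rw [← h2, 𝓘(ℝ, E).range_eq_univ, mfderivWithin_univ]
    rw [h4] at h3 ⊢
    exact h3.inverse_apply_eq.2 rfl
  have hx := mem_chart_source E x₀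
  have hi := isInvertible_mfderiv_extChartAt (I := 𝓘(ℝ, E)) (mem_extChartAt_source x₀)
  have hb : ∀ {v' w' : E → E}, v' =ᶠ[𝓝 (extChartAt 𝓘(ℝ, E) x₀ x₀)] v →
      w' =ᶠ[𝓝 (extChartAt 𝓘(ℝ, E) x₀ x₀)] w →
      lieBracketWithin ℝ v' w' ((extChartAt 𝓘(ℝ, E) x₀).symm ⁻¹' univ ∩ range 𝓘(ℝ, E))
        (extChartAt 𝓘(ℝ, E) x₀ x₀) = lieBracket ℝ v w (extChartAt 𝓘(ℝ, E) x₀ x₀) := by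
    intro v' w' hv hw
    rw [show (extChartAt 𝓘(ℝ, E) x₀).symm ⁻¹' univ ∩ range 𝓘(ℝ, E) = univ by simp,
      lieBracketWithin_univ]
    exact hv.lieBracket_vectorField_eq hw
  -- By definition `mlieBracket` is the bracket of the fields read in the chart, pulled back by the
  -- inverse of the derivative of the chart.
  refine hi.inverse_apply_eq.2 ((hb (aux hX) (aux hY)).trans ?_)
  rw [(hasMFDerivAt_chartAt hx).mfderiv]
  exact (tangentCoord_tangentCoordSymm hx _).symm

theorem mdifferentiableAt_chartAt_symm_comp {x₀ : N} {φ : F → E} {z : F}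
    (hz : φ z ∈ (extChartAt 𝓘(ℝ, E) x₀).target) (hφ : DifferentiableAt ℝ φ z) :
    MDifferentiableAt 𝓘(ℝ, F) 𝓘(ℝ, E) (fun y ↦ (extChartAt 𝓘(ℝ, E) x₀).symm (φ y)) z :=
  (hasMFDerivAt_chartAt_symm hz).mdifferentiableAt.comp z hφ.mdifferentiableAt

section

variable {E' : Type*} [NormedAddCommGroup E'] [NormedSpace ℝ E']
  {M : Type*} [TopologicalSpace M] [ChartedSpace E' M] [IsManifold 𝓘(ℝ, E') ∞ M]

/-- The derivative of a map between manifolds, read in charts. -/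
theorem fderiv_inCharts {f : N → M} {x₀ : N} {y₀ : M} {φ : F → E} {z : F}
    (hz : φ z ∈ (extChartAt 𝓘(ℝ, E) x₀).target) (hφ : DifferentiableAt ℝ φ z)
    (hf : MDifferentiable 𝓘(ℝ, E) 𝓘(ℝ, E') f)
    (hfz : f ((extChartAt 𝓘(ℝ, E) x₀).symm (φ z)) ∈ (chartAt E' y₀).source) :
    DifferentiableAt ℝ
      (fun y ↦ extChartAt 𝓘(ℝ, E') y₀ (f ((extChartAt 𝓘(ℝ, E) x₀).symm (φ y)))) z ∧
    ∀ w, fderiv ℝ (fun y ↦ extChartAt 𝓘(ℝ, E') y₀ (f ((extChartAt 𝓘(ℝ, E) x₀).symm (φ y)))) z w =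
      tangentCoord y₀ (f ((extChartAt 𝓘(ℝ, E) x₀).symm (φ z)))
        (mfderiv 𝓘(ℝ, E) 𝓘(ℝ, E') f ((extChartAt 𝓘(ℝ, E) x₀).symm (φ z))
          (tangentCoordSymm x₀ ((extChartAt 𝓘(ℝ, E) x₀).symm (φ z)) (fderiv ℝ φ z w))) := by
  have h1 := mdifferentiableAt_chartAt_symm_comp hz hφ
  have h2 : MDifferentiableAt 𝓘(ℝ, F) 𝓘(ℝ, E')
      (fun y ↦ f ((extChartAt 𝓘(ℝ, E) x₀).symm (φ y))) z := (hf _).comp z h1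
  refine ⟨differentiableAt_chartAt_comp h2 hfz, fun w ↦ ?_⟩
  rw [fderiv_chartAt_comp h2 hfz, ← mfderiv_chartAt_symm_comp hz hφ]
  exact congrArg _ (mfderiv_comp_apply z (hf _) h1 w)

end

end Coordinates

/-! ### The Nijenhuis tensor in charts and along smooth maps. -/

namespace VForm

variable {E : Type*} [NormedAddCommGroup E] [NormedSpace ℝ E]
  {N : Type*} [TopologicalSpace N] [ChartedSpace E N] [IsManifold 𝓘(ℝ, E) ∞ N]
  {F : Type*} [NormedAddCommGroup F] [NormedSpace ℝ F]

/-- The coordinate representation of a vector-valued `1`-form in the preferred chart at `x₀`. -/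
noncomputable def inChart (K : VForm E N 1) (x₀ : N) (y : E) : E →L[ℝ] E :=
  (tangentCoord x₀ ((extChartAt 𝓘(ℝ, E) x₀).symm y)).comp
    ((K.endo ((extChartAt 𝓘(ℝ, E) x₀).symm y)).comp
      (tangentCoordSymm x₀ ((extChartAt 𝓘(ℝ, E) x₀).symm y)))

theorem inChart_tangentCoord (K : VForm E N 1) {x₀ x : N} (hx : x ∈ (chartAt E x₀).source)
    (v : TangentSpace 𝓘(ℝ, E) x) :
    K.inChart x₀ (extChartAt 𝓘(ℝ, E) x₀ x) (tangentCoord x₀ x v) =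
      tangentCoord x₀ x (K.endo x v) := by
  have h : (extChartAt 𝓘(ℝ, E) x₀).symm (extChartAt 𝓘(ℝ, E) x₀ x) = x :=
    (extChartAt 𝓘(ℝ, E) x₀).left_inv (by simpa using hx)
  change tangentCoord x₀ _ (K.endo _ (tangentCoordSymm x₀ _ _)) = _
  rw [h, tangentCoordSymm_tangentCoord hx]

theorem endo_tangentCoordSymm (K : VForm E N 1) {x₀ x : N} (hx : x ∈ (chartAt E x₀).source)
    (v : E) :
    K.endo x (tangentCoordSymm x₀ x v) =
      tangentCoordSymm x₀ x (K.inChart x₀ (extChartAt 𝓘(ℝ, E) x₀ x) v) := by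
  apply tangentCoord_injective hx
  rw [tangentCoord_tangentCoordSymm hx, ← inChart_tangentCoord K hx,
    tangentCoord_tangentCoordSymm hx]

/-- Smoothness at the centre of the chart suffices, since charts are always chosen centred at the
point under study. -/
theorem contDiffAt_inChart (K : VForm E N 1) (x₀ : N) :
    ContDiffAt ℝ ∞ (K.inChart x₀) (extChartAt 𝓘(ℝ, E) x₀ x₀) := by
  have h := ((contMDiffAt_hom_bundle _).1 (K.contMDiff_endo x₀)).2
  have h2 := contMDiffOn_extChartAt_symm (I := 𝓘(ℝ, E)) (n := ∞) x₀
  have h3 := h2.contMDiffAt (extChartAt_target_mem_nhds (I := 𝓘(ℝ, E)) x₀)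
  exact (h.comp_of_eq h3 (extChartAt_to_inv x₀)).contDiffAt

variable [FiniteDimensional ℝ E]

/-- By tensoriality N_K may be evaluated on the fields with constant coordinates in the chart. Their
own bracket vanishes, and the other brackets reduce to first derivatives of the matrix of K. -/
theorem tangentCoord_nijenhuis (K : VForm E N 1) (x₀ : N) (u v : TangentSpace 𝓘(ℝ, E) x₀) :
    tangentCoord x₀ x₀ (K.nijenhuis.toFun x₀ ![u, v]) =
      nijenhuisModel (K.inChart x₀) (extChartAt 𝓘(ℝ, E) x₀ x₀) (tangentCoord x₀ x₀ u)
        (tangentCoord x₀ x₀ v) := by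
  have hx := mem_chart_source E x₀
  have hev : ∀ᶠ x in 𝓝 x₀, x ∈ (chartAt E x₀).source := chart_source_mem_nhds E x₀
  have hA := (K.contDiffAt_inChart x₀).differentiableAt (by simp)
  set A := K.inChart x₀ with hAK
  set y := extChartAt 𝓘(ℝ, E) x₀ x₀ with hy
  set a := tangentCoord x₀ x₀ u
  set b := tangentCoord x₀ x₀ v
  let X : E → ∀ x : N, TangentSpace 𝓘(ℝ, E) x := fun c x ↦ tangentCoordSymm x₀ x c
  have hXu : X a x₀ = u := tangentCoordSymm_tangentCoord hx u
  have hXv : X b x₀ = v := tangentCoordSymm_tangentCoord hx v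
  have hX : ∀ c, ∀ᶠ x in 𝓝 x₀,
      X c x = tangentCoordSymm x₀ x ((fun _ ↦ c) (extChartAt 𝓘(ℝ, E) x₀ x)) :=
    fun c ↦ Filter.Eventually.of_forall fun _ ↦ rfl
  have hKX : ∀ c, ∀ᶠ x in 𝓝 x₀,
      K.app (X c) x = tangentCoordSymm x₀ x ((fun y ↦ A y c) (extChartAt 𝓘(ℝ, E) x₀ x)) := by
    intro c
    filter_upwards [hev] with x hx using K.endo_tangentCoordSymm hx c
  have hd : ∀ c w, fderiv ℝ (fun y ↦ A y c) y w = fderiv ℝ A y w c := fun c w ↦ by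
    rw [(hA.hasFDerivAt.clm_apply (hasFDerivAt_const c y)).fderiv]
    simp
  have h0 : ∀ c w : E, fderiv ℝ (fun _ : E ↦ c) y w = 0 := by simp
  have hn := K.nijenhuis_apply (mdifferentiableAt_tangentCoordSymm x₀ a)
    (mdifferentiableAt_tangentCoordSymm x₀ b)
  change K.nijenhuis.toFun x₀ ![X a x₀, X b x₀] = _ at hn
  rw [hXu, hXv] at hn
  rw [hn]
  change tangentCoord x₀ x₀ (mlieBracket 𝓘(ℝ, E) (K.app (X a)) (K.app (X b)) x₀
    - K.endo x₀ (mlieBracket 𝓘(ℝ, E) (K.app (X a)) (X b) x₀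
    + mlieBracket 𝓘(ℝ, E) (X a) (K.app (X b)) x₀)
        + K.endo x₀ (K.endo x₀ (mlieBracket 𝓘(ℝ, E) (X a) (X b) x₀))) = _
  rw [mlieBracket_eq_lieBracket (v := fun y ↦ A y a) (w := fun y ↦ A y b) (hKX a) (hKX b),
    mlieBracket_eq_lieBracket (v := fun y ↦ A y a) (w := fun _ ↦ b) (hKX a) (hX b),
    mlieBracket_eq_lieBracket (v := fun _ ↦ a) (w := fun y ↦ A y b) (hX a) (hKX b),
    mlieBracket_eq_lieBracket (v := fun _ ↦ a) (w := fun _ ↦ b) (hX a) (hX b)]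
  simp only [map_add, map_sub, K.endo_tangentCoordSymm hx, tangentCoord_tangentCoordSymm hx,
    lieBracket, ← hAK, ← hy, hd, h0, nijenhuisModel, map_zero]
  abel

/-- If `A` is a field of endomorphisms of a vector space that is related to `K` by `ψ`, then their
Nijenhuis tensors are related by `ψ`. -/
theorem nijenhuis_map (K : VForm E N 1) {ψ : F → N} {A : F → F →L[ℝ] F} {z : F}
    (hψ : ContMDiffAt 𝓘(ℝ, F) 𝓘(ℝ, E) ∞ ψ z) (hA : DifferentiableAt ℝ A z)
    (h : ∀ᶠ y in 𝓝 z, ∀ w : F, mfderiv 𝓘(ℝ, F) 𝓘(ℝ, E) ψ y (A y w) =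
      K.endo (ψ y) (mfderiv 𝓘(ℝ, F) 𝓘(ℝ, E) ψ y w)) (u v : F) :
    K.nijenhuis.toFun (ψ z) ![mfderiv 𝓘(ℝ, F) 𝓘(ℝ, E) ψ z u, mfderiv 𝓘(ℝ, F) 𝓘(ℝ, E) ψ z v] =
      mfderiv 𝓘(ℝ, F) 𝓘(ℝ, E) ψ z (nijenhuisModel (F := F) A z u v) := by
  have hz := mem_chart_source E (ψ z)
  have hev : ∀ᶠ y in 𝓝 z, ψ y ∈ (chartAt E (ψ z)).source :=
    hψ.continuousAt.eventually (chart_source_mem_nhds E (ψ z))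
  have hmd := hψ.mdifferentiableAt (by simp)
  apply tangentCoord_injective hz
  rw [tangentCoord_nijenhuis, ← fderiv_chartAt_comp hmd hz, ← fderiv_chartAt_comp hmd hz,
    ← fderiv_chartAt_comp hmd hz]
  refine nijenhuisModel_map (contDiffAt_chartAt_comp hψ rfl) hA
    ((K.contDiffAt_inChart (ψ z)).differentiableAt (by simp)) ?_ u v
  filter_upwards [h, hev, eventually_mdifferentiableAt hψ] with y hy hys hyd w
  rw [fderiv_chartAt_comp hyd hys, fderiv_chartAt_comp hyd hys, K.inChart_tangentCoord hys, hy]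

/-- If two vector-valued `1`-forms are related by a smooth map, so are their Nijenhuis tensors. -/
theorem nijenhuis_related {E' : Type*} [NormedAddCommGroup E'] [NormedSpace ℝ E']
    [FiniteDimensional ℝ E'] {N' : Type*} [TopologicalSpace N'] [ChartedSpace E' N']
    [IsManifold 𝓘(ℝ, E') ∞ N'] {K : VForm E N 1} {K' : VForm E' N' 1} {f : N → N'}
    (hf : ContMDiff 𝓘(ℝ, E) 𝓘(ℝ, E') ∞ f)
    (h : ∀ x (v : TangentSpace 𝓘(ℝ, E) x), mfderiv 𝓘(ℝ, E) 𝓘(ℝ, E') f x (K.endo x v) =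
      K'.endo (f x) (mfderiv 𝓘(ℝ, E) 𝓘(ℝ, E') f x v)) (x : N) (v : Fin 2 → TangentSpace 𝓘(ℝ, E) x) :
    mfderiv 𝓘(ℝ, E) 𝓘(ℝ, E') f x (K.nijenhuis.toFun x v) =
      K'.nijenhuis.toFun (f x) (fun i ↦ mfderiv 𝓘(ℝ, E) 𝓘(ℝ, E') f x (v i)) := by
  -- φ is the inverse chart and A is K in coordinates. Packaging them existentially lets x be
  -- replaced by φ z, so no transport between tangent spaces is needed.
  obtain ⟨φ, z, A, rfl, hφ, hA, hrel, hsurj⟩ : ∃ (φ : E → N) (z : E) (A : E → E →L[ℝ] E), φ z = x ∧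
      ContMDiffAt 𝓘(ℝ, E) 𝓘(ℝ, E) ∞ φ z ∧ DifferentiableAt ℝ A z ∧
      (∀ᶠ y in 𝓝 z, ∀ w : E, mfderiv 𝓘(ℝ, E) 𝓘(ℝ, E) φ y (A y w) =
        K.endo (φ y) (mfderiv 𝓘(ℝ, E) 𝓘(ℝ, E) φ y w)) ∧
      ∀ w : TangentSpace 𝓘(ℝ, E) (φ z), ∃ u : E, mfderiv 𝓘(ℝ, E) 𝓘(ℝ, E) φ z u = w := by
    have ht := extChartAt_target_mem_nhds (I := 𝓘(ℝ, E)) x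
    have hsrc : ∀ y ∈ (extChartAt 𝓘(ℝ, E) x).target,
        (extChartAt 𝓘(ℝ, E) x).symm y ∈ (chartAt E x).source := fun y hy ↦ by
      simpa using (extChartAt 𝓘(ℝ, E) x).map_target hy
    refine ⟨(extChartAt 𝓘(ℝ, E) x).symm, extChartAt 𝓘(ℝ, E) x x, K.inChart x, extChartAt_to_inv x,
      (contMDiffOn_extChartAt_symm x).contMDiffAt ht,
      (K.contDiffAt_inChart x).differentiableAt (by simp), ?_, ?_⟩
    · filter_upwards [ht] with y hy w
      have hw := K.endo_tangentCoordSymm (hsrc y hy) w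
      rw [(extChartAt 𝓘(ℝ, E) x).right_inv hy] at hw
      rw [mfderiv_chartAt_symm hy, mfderiv_chartAt_symm hy, hw]
    · intro w
      exact ⟨_, (mfderiv_chartAt_symm (mem_of_mem_nhds ht) _).trans
        (tangentCoordSymm_tangentCoord (hsrc _ (mem_of_mem_nhds ht)) w)⟩
  have hcomp : ∀ {y : E}, MDifferentiableAt 𝓘(ℝ, E) 𝓘(ℝ, E) φ y → ∀ w : E,
      mfderiv 𝓘(ℝ, E) 𝓘(ℝ, E') (fun y ↦ f (φ y)) y w =
        mfderiv 𝓘(ℝ, E) 𝓘(ℝ, E') f (φ y) (mfderiv 𝓘(ℝ, E) 𝓘(ℝ, E) φ y w) := fun hy w ↦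
    mfderiv_comp_apply _ ((hf _).mdifferentiableAt (by simp)) hy w
  have hφz := hφ.mdifferentiableAt (by simp)
  obtain ⟨a, ha⟩ := hsurj (v 0)
  obtain ⟨b, hb⟩ := hsurj (v 1)
  have hv : v = ![v 0, v 1] := by ext i; fin_cases i <;> rfl
  have h1 := K.nijenhuis_map hφ hA hrel a b
  -- The same A is related to K' along f ∘ φ, so both Nijenhuis tensors are images of that of A.
  have h2 := K'.nijenhuis_map (ψ := fun y ↦ f (φ y)) ((hf (φ z)).comp z hφ) hA (by
    filter_upwards [hrel, eventually_mdifferentiableAt hφ] with y hy hyd w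
    rw [hcomp hyd, hcomp hyd, hy, h]) a b
  rw [hcomp hφz, hcomp hφz, hcomp hφz, ha, hb, ← h1, ha, hb] at h2
  rw [hv, ← h2]
  congr 1
  ext i
  fin_cases i <;> rfl

end VForm
-- Surjectivity of the derivative of a submersion.
section Submersion

variable {E : Type*} [NormedAddCommGroup E] [NormedSpace ℝ E]
  {N : Type*} [TopologicalSpace N] [ChartedSpace E N]
  {E' : Type*} [NormedAddCommGroup E'] [NormedSpace ℝ E']
  {M : Type*} [TopologicalSpace M] [ChartedSpace E' M]

theorem mdifferentiable_of_mem_maximalAtlas {e : OpenPartialHomeomorph N E}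
    (he : e ∈ IsManifold.maximalAtlas 𝓘(ℝ, E) ∞ N) : e.MDifferentiable 𝓘(ℝ, E) 𝓘(ℝ, E) :=
  ⟨(contMDiffOn_of_mem_maximalAtlas he).mdifferentiableOn (by simp),
    (contMDiffOn_symm_of_mem_maximalAtlas he).mdifferentiableOn (by simp)⟩

/-- The derivative of a submersion is surjective. -/
theorem mfderiv_surjective_of_isSubmersionAt {f : N → M} {x : N}
    (hf : IsSubmersionAt 𝓘(ℝ, E) 𝓘(ℝ, E') ∞ f x) :
    Function.Surjective (mfderiv 𝓘(ℝ, E) 𝓘(ℝ, E') f x) := by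
  have hd := mdifferentiable_of_mem_maximalAtlas hf.domChart_mem_maximalAtlas
  have hc := mdifferentiable_of_mem_maximalAtlas hf.codChart_mem_maximalAtlas
  have hx := hf.mem_domChart_source
  have hfx := hf.mem_codChart_source
  have hfd : MDifferentiableAt 𝓘(ℝ, E) 𝓘(ℝ, E') f x := hf.contMDiffAt.mdifferentiableAt (by simp)
  let L : E →L[ℝ] E' := (ContinuousLinearMap.fst ℝ E' hf.complement).comp
    (hf.equiv : E →L[ℝ] E' × hf.complement)
  -- The local normal form: in adapted charts f is the linear projection L, which is visibly onto.
  have heq : (fun y ↦ hf.codChart (f y)) =ᶠ[𝓝 x] fun y ↦ L (hf.domChart y) := by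
    filter_upwards [hf.domChart.open_source.mem_nhds hx] with y hy
    have hy' : hf.domChart y ∈ (hf.domChart.extend 𝓘(ℝ, E)).target := by
      simpa using hf.domChart.map_source hy
    simpa [L, hf.domChart.left_inv hy] using hf.writtenInCharts hy'
  have h1 := (hc.mdifferentiableAt hfx).hasMFDerivAt.comp x hfd.hasMFDerivAt
  have h2 := (L.hasFDerivAt (x := hf.domChart x)).hasMFDerivAt.comp x
    (hd.mdifferentiableAt hx).hasMFDerivAt
  have h3 := hasMFDerivAt_unique (h2.congr_of_eventuallyEq heq) h1
  intro w
  obtain ⟨v, hv⟩ : ∃ v : E, L v = mfderiv 𝓘(ℝ, E') 𝓘(ℝ, E') hf.codChart (f x) w :=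
    ⟨hf.equiv.symm (mfderiv 𝓘(ℝ, E') 𝓘(ℝ, E') hf.codChart (f x) w, 0),
      congrArg Prod.fst (hf.equiv.apply_symm_apply _)⟩
  obtain ⟨u, rfl⟩ := hd.mfderiv_surjective hx v
  exact ⟨u, hc.mfderiv_injective hfx ((congrArg (fun A ↦ A u) h3).symm.trans hv)⟩

end Submersion

/-! ### Local parametrization of the composable pairs. -/

namespace LieGroupoid

variable {E : Type*} [NormedAddCommGroup E] [NormedSpace ℝ E]
  {G : Type*} [TopologicalSpace G] [ChartedSpace E G] [IsManifold 𝓘(ℝ, E) ∞ G]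
  {E' : Type*} [NormedAddCommGroup E'] [NormedSpace ℝ E']
  {M : Type*} [TopologicalSpace M] [ChartedSpace E' M] [IsManifold 𝓘(ℝ, E') ∞ M]

/-- Near a composable pair, the composable pairs are parametrized by a vector space, and
`K` is related under this parametrization to a field `A` of endomorphisms. -/
theorem exists_composable_parametrization [FiniteDimensional ℝ E] [FiniteDimensional ℝ E']
    (𝒢 : LieGroupoid E G E' M) {K : VForm E G 1} {K_M : VForm E' M 1}
    (hs : ∀ g (v : TangentSpace 𝓘(ℝ, E) g), mfderiv 𝓘(ℝ, E) 𝓘(ℝ, E') 𝒢.source g (K.endo g v) =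
      K_M.endo (𝒢.source g) (mfderiv 𝓘(ℝ, E) 𝓘(ℝ, E') 𝒢.source g v))
    (ht : ∀ g (v : TangentSpace 𝓘(ℝ, E) g), mfderiv 𝓘(ℝ, E) 𝓘(ℝ, E') 𝒢.target g (K.endo g v) =
      K_M.endo (𝒢.target g) (mfderiv 𝓘(ℝ, E) 𝓘(ℝ, E') 𝒢.target g v))
    {g h : G} (hgh : 𝒢.source g = 𝒢.target h) :
    ∃ (S : Submodule ℝ (E × E)) (φ₁ φ₂ : S → G) (A : S → S →L[ℝ] S), φ₁ 0 = g ∧ φ₂ 0 = h ∧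
      ContMDiffAt 𝓘(ℝ, S) 𝓘(ℝ, E) ∞ φ₁ 0 ∧ ContMDiffAt 𝓘(ℝ, S) 𝓘(ℝ, E) ∞ φ₂ 0 ∧
      DifferentiableAt ℝ A 0 ∧ (∀ᶠ z in 𝓝 0, 𝒢.source (φ₁ z) = 𝒢.target (φ₂ z)) ∧
      (∀ᶠ z in 𝓝 0, ∀ u : S, mfderiv 𝓘(ℝ, S) 𝓘(ℝ, E) φ₁ z (A z u) =
        K.endo (φ₁ z) (mfderiv 𝓘(ℝ, S) 𝓘(ℝ, E) φ₁ z u)) ∧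
      (∀ᶠ z in 𝓝 0, ∀ u : S, mfderiv 𝓘(ℝ, S) 𝓘(ℝ, E) φ₂ z (A z u) =
        K.endo (φ₂ z) (mfderiv 𝓘(ℝ, S) 𝓘(ℝ, E) φ₂ z u)) ∧
      ∀ (X : TangentSpace 𝓘(ℝ, E) (φ₁ 0)) (Y : TangentSpace 𝓘(ℝ, E) (φ₂ 0)),
        @Eq E' (mfderiv 𝓘(ℝ, E) 𝓘(ℝ, E') 𝒢.source (φ₁ 0) X)
          (mfderiv 𝓘(ℝ, E) 𝓘(ℝ, E') 𝒢.target (φ₂ 0) Y) →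
        ∃ u : S, mfderiv 𝓘(ℝ, S) 𝓘(ℝ, E) φ₁ 0 u = X ∧ mfderiv 𝓘(ℝ, S) 𝓘(ℝ, E) φ₂ 0 u = Y := by
  let κ₁ := extChartAt 𝓘(ℝ, E) g
  let κ₂ := extChartAt 𝓘(ℝ, E) h
  let κ := extChartAt 𝓘(ℝ, E') (𝒢.source g)
  let p : E × E := (κ₁ g, κ₂ h)
  let a₁ : E × E → G := fun y ↦ κ₁.symm y.1
  let a₂ : E × E → G := fun y ↦ κ₂.symm y.2
  have hp₁ : a₁ p = g := extChartAt_to_inv g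
  have hp₂ : a₂ p = h := extChartAt_to_inv h
  have hsm : ContMDiff 𝓘(ℝ, E) 𝓘(ℝ, E') ∞ 𝒢.source := 𝒢.submersion_source.contMDiff
  have htm : ContMDiff 𝓘(ℝ, E) 𝓘(ℝ, E') ∞ 𝒢.target := 𝒢.submersion_target.contMDiff
  have hs' : MDifferentiable 𝓘(ℝ, E) 𝓘(ℝ, E') 𝒢.source :=
    fun x ↦ (hsm x).mdifferentiableAt (by simp)
  have ht' : MDifferentiable 𝓘(ℝ, E) 𝓘(ℝ, E') 𝒢.target :=
    fun x ↦ (htm x).mdifferentiableAt (by simp)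
  have ha₁ : ContMDiffAt 𝓘(ℝ, E × E) 𝓘(ℝ, E) ∞ a₁ p :=
    ((contMDiffOn_extChartAt_symm g).contMDiffAt (extChartAt_target_mem_nhds g)).comp p
      contDiff_fst.contMDiff.contMDiffAt
  have ha₂ : ContMDiffAt 𝓘(ℝ, E × E) 𝓘(ℝ, E) ∞ a₂ p :=
    ((contMDiffOn_extChartAt_symm h).contMDiffAt (extChartAt_target_mem_nhds h)).comp p
      contDiff_snd.contMDiff.contMDiffAt
  have hb₁ : ContMDiffAt 𝓘(ℝ, E × E) 𝓘(ℝ, E') ∞ (fun y ↦ 𝒢.source (a₁ y)) p :=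
    (hsm (a₁ p)).comp p ha₁
  have hb₂ : ContMDiffAt 𝓘(ℝ, E × E) 𝓘(ℝ, E') ∞ (fun y ↦ 𝒢.target (a₂ y)) p :=
    (htm (a₂ p)).comp p ha₂
  have hbp₁ : 𝒢.source (a₁ p) = 𝒢.source g := by rw [hp₁]
  have hbp₂ : 𝒢.target (a₂ p) = 𝒢.source g := by rw [hp₂, hgh]
  have hc₁ := contDiffAt_chartAt_comp hb₁ hbp₁
  have hc₂ := contDiffAt_chartAt_comp hb₂ hbp₂
  -- Near p its zeros are the composable pairs in coordinates. One chart κ serves both terms because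
  -- source g = target h.
  let f : E × E → E' := fun y ↦ κ (𝒢.source (a₁ y)) - κ (𝒢.target (a₂ y))
  have hf : ContDiffAt ℝ ∞ f p := hc₁.sub hc₂
  have hfp : f p = 0 := by
    simp only [f, hbp₁, hbp₂, sub_self]
  let U : Set (E × E) := {y | y.1 ∈ κ₁.target ∧ y.2 ∈ κ₂.target ∧
    𝒢.source (a₁ y) ∈ (chartAt E' (𝒢.source g)).source ∧
    𝒢.target (a₂ y) ∈ (chartAt E' (𝒢.source g)).source}
  have hU : ∀ᶠ y in 𝓝 p, y ∈ U := by
    have h1 : ∀ᶠ y : E × E in 𝓝 p, y.1 ∈ κ₁.target :=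
      continuousAt_fst.preimage_mem_nhds (extChartAt_target_mem_nhds (I := 𝓘(ℝ, E)) g)
    have h2 : ∀ᶠ y : E × E in 𝓝 p, y.2 ∈ κ₂.target :=
      continuousAt_snd.preimage_mem_nhds (extChartAt_target_mem_nhds (I := 𝓘(ℝ, E)) h)
    have h3 : ∀ᶠ y in 𝓝 p, 𝒢.source (a₁ y) ∈ (chartAt E' (𝒢.source g)).source :=
      hb₁.continuousAt.preimage_mem_nhds (by rw [hbp₁]; exact chart_source_mem_nhds E' _)
    have h4 : ∀ᶠ y in 𝓝 p, 𝒢.target (a₂ y) ∈ (chartAt E' (𝒢.source g)).source :=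
      hb₂.continuousAt.preimage_mem_nhds (by rw [hbp₂]; exact chart_source_mem_nhds E' _)
    filter_upwards [h1, h2, h3, h4] with y h1 h2 h3 h4 using ⟨h1, h2, h3, h4⟩
  have hfd : ∀ y ∈ U, ∀ w : E × E, fderiv ℝ f y w =
      tangentCoord (𝒢.source g) (𝒢.source (a₁ y)) (mfderiv 𝓘(ℝ, E) 𝓘(ℝ, E') 𝒢.source (a₁ y)
        (tangentCoordSymm g (a₁ y) w.1)) -
      tangentCoord (𝒢.source g) (𝒢.target (a₂ y)) (mfderiv 𝓘(ℝ, E) 𝓘(ℝ, E') 𝒢.target (a₂ y)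
        (tangentCoordSymm h (a₂ y) w.2)) := by
    intro y hy w
    obtain ⟨d1, e1⟩ := fderiv_inCharts (F := E × E) (φ := Prod.fst) hy.1 differentiableAt_fst
      hs' hy.2.2.1
    obtain ⟨d2, e2⟩ := fderiv_inCharts (F := E × E) (φ := Prod.snd) hy.2.1 differentiableAt_snd
      ht' hy.2.2.2
    rw [show fderiv ℝ f y = _ from (d1.hasFDerivAt.sub d2.hasFDerivAt).fderiv,
      sub_apply, e1, e2, fderiv_fst, fderiv_snd]
    rfl
  have hsurj : Function.Surjective (fderiv ℝ f p) := by
    intro e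
    have hpU := hU.self_of_nhds
    obtain ⟨X, hX⟩ := mfderiv_surjective_of_isSubmersionAt
      (𝒢.submersion_source.isSubmersionAt (a₁ p))
      (tangentCoordSymm (𝒢.source g) (𝒢.source (a₁ p)) e)
    -- The source is already a submersion, so the second component can be zero.
    refine ⟨(tangentCoord g (a₁ p) X, 0), ?_⟩
    rw [hfd p hpU, tangentCoordSymm_tangentCoord (by rw [hp₁]; exact mem_chart_source E g), hX,
      tangentCoord_tangentCoordSymm hpU.2.2.1]
    simp
  obtain ⟨S, φ, ρ, hφ0, hφ, hρ, hφf, hφρ⟩ := exists_parametrization hf hsurj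
  rw [hfp] at hφf
  let 𝒦 : E × E → (E × E) →L[ℝ] (E × E) := fun y ↦ (K.inChart g y.1).prodMap (K.inChart h y.2)
  have h𝒦 : ∀ y w, 𝒦 y w = (K.inChart g y.1 w.1, K.inChart h y.2 w.2) := fun y w ↦ rfl
  have h𝒦d : ContDiffAt ℝ ∞ 𝒦 p :=
    contDiffAt_prodMap (K.contDiffAt_inChart g) (K.contDiffAt_inChart h)
  have hφU : ∀ᶠ z in 𝓝 0, φ z ∈ U := hφ.continuousAt.eventually (hφ0.symm ▸ hU)
  have hφd : ∀ᶠ z in 𝓝 0, DifferentiableAt ℝ φ z := by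
    filter_upwards [(hφ.of_le (m := 1) (by norm_cast)).eventually (by simp)] with z hz
    exact hz.differentiableAt one_ne_zero
  have hm₁ : ∀ z, φ z ∈ U → DifferentiableAt ℝ φ z → ∀ u : S,
      mfderiv 𝓘(ℝ, S) 𝓘(ℝ, E) (fun z ↦ a₁ (φ z)) z u =
        tangentCoordSymm g (a₁ (φ z)) (fderiv ℝ φ z u).1 := by
    intro z hz hd u
    have h1 := mfderiv_chartAt_symm_comp (φ := fun z ↦ (φ z).1) hz.1 hd.fst u
    rwa [fderiv.fst hd] at h1
  have hm₂ : ∀ z, φ z ∈ U → DifferentiableAt ℝ φ z → ∀ u : S,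
      mfderiv 𝓘(ℝ, S) 𝓘(ℝ, E) (fun z ↦ a₂ (φ z)) z u =
        tangentCoordSymm h (a₂ (φ z)) (fderiv ℝ φ z u).2 := by
    intro z hz hd u
    have h1 := mfderiv_chartAt_symm_comp (φ := fun z ↦ (φ z).2) hz.2.1 hd.snd u
    rwa [fderiv.snd hd] at h1
  have hsrc₁ : ∀ y ∈ U, a₁ y ∈ (chartAt E g).source := fun y hy ↦ by
    simpa [κ₁, a₁] using κ₁.map_target hy.1
  have hsrc₂ : ∀ y ∈ U, a₂ y ∈ (chartAt E h).source := fun y hy ↦ by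
    simpa [κ₂, a₂] using κ₂.map_target hy.2.1
  have hK₁ : ∀ y ∈ U, ∀ w, K.endo (a₁ y) (tangentCoordSymm g (a₁ y) w) =
      tangentCoordSymm g (a₁ y) (K.inChart g y.1 w) := fun y hy w ↦ by
    have := K.endo_tangentCoordSymm (hsrc₁ y hy) w
    rwa [κ₁.right_inv hy.1] at this
  have hK₂ : ∀ y ∈ U, ∀ w, K.endo (a₂ y) (tangentCoordSymm h (a₂ y) w) =
      tangentCoordSymm h (a₂ y) (K.inChart h y.2 w) := fun y hy w ↦ by
    have := K.endo_tangentCoordSymm (hsrc₂ y hy) w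
    rwa [κ₂.right_inv hy.2.1] at this
  -- Dρ lifts through Dφ only those vectors that lie in ker Df. Hence A is related to 𝒦 along φ once
  -- 𝒦 is known to preserve this kernel on the image of Dφ.
  let A : S → S →L[ℝ] S := fun z ↦ (fderiv ℝ ρ (φ z)).comp ((𝒦 (φ z)).comp (fderiv ℝ φ z))
  have hA : DifferentiableAt ℝ A 0 := by
    have h1 : ContDiffAt ℝ 1 (fun z ↦ fderiv ℝ ρ (φ z)) 0 :=
      ContDiffAt.comp (0 : S) (hφ0.symm ▸ hρ.fderiv_right (m := 1) (by norm_cast))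
        (hφ.of_le (by norm_cast))
    have h2 : ContDiffAt ℝ 1 (fun z ↦ 𝒦 (φ z)) 0 :=
      ContDiffAt.comp (0 : S) (hφ0.symm ▸ h𝒦d.of_le (by norm_cast)) (hφ.of_le (by norm_cast))
    have h3 : ContDiffAt ℝ 1 (fderiv ℝ φ) 0 := hφ.fderiv_right (by norm_cast)
    exact (h1.clm_comp (h2.clm_comp h3)).differentiableAt one_ne_zero
  have hrel : ∀ᶠ z in 𝓝 0, ∀ u, fderiv ℝ φ z (A z u) = 𝒦 (φ z) (fderiv ℝ φ z u) := by
    have hfd' : ∀ᶠ y in 𝓝 p, DifferentiableAt ℝ f y := by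
      filter_upwards [(hf.of_le (m := 1) (by norm_cast)).eventually (by simp)] with y hy
      exact hy.differentiableAt one_ne_zero
    filter_upwards [hφρ, hφU, hφd, hφf.eventually_nhds,
      hφ.continuousAt.eventually (hφ0.symm ▸ hfd')] with z hz hzU hzd hzf hfz u
    -- It remains to see Df (𝒦 w) = 0. Since f ∘ φ vanishes near z, Df w = 0. Both terms of Df pass
    -- K on to K_M at the same base point, so K_M acts on two equal vectors.
    refine hz _ ?_
    set w := fderiv ℝ φ z u
    have h0 : fderiv ℝ f (φ z) w = 0 := by
      have h1 := hfz.hasFDerivAt.comp z hzd.hasFDerivAt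
      have h2 : HasFDerivAt (f ∘ φ) (0 : S →L[ℝ] E') z :=
        (hasFDerivAt_const (0 : E') z).congr_of_eventuallyEq hzf
      exact congrArg (fun L ↦ L u) (h1.unique h2)
    have h1 : κ (𝒢.source (a₁ (φ z))) = κ (𝒢.target (a₂ (φ z))) :=
      sub_eq_zero.1 hzf.self_of_nhds
    rw [hfd _ hzU, sub_eq_zero] at h0 ⊢
    change tangentCoord _ _ (mfderiv 𝓘(ℝ, E) 𝓘(ℝ, E') 𝒢.source _ (tangentCoordSymm g (a₁ (φ z))
        (K.inChart g (φ z).1 w.1))) =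
      tangentCoord _ _ (mfderiv 𝓘(ℝ, E) 𝓘(ℝ, E') 𝒢.target _ (tangentCoordSymm h (a₂ (φ z))
        (K.inChart h (φ z).2 w.2)))
    rw [← hK₁ _ hzU, ← hK₂ _ hzU, hs, ht, ← K_M.inChart_tangentCoord hzU.2.2.1,
      ← K_M.inChart_tangentCoord hzU.2.2.2, h0]
    exact congrArg (fun y ↦ K_M.inChart (𝒢.source g) y _) h1
  refine ⟨S, fun z ↦ a₁ (φ z), fun z ↦ a₂ (φ z), A, (congrArg a₁ hφ0).trans hp₁,
    (congrArg a₂ hφ0).trans hp₂,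
    ha₁.comp_of_eq hφ.contMDiffAt hφ0, ha₂.comp_of_eq hφ.contMDiffAt hφ0, hA, ?_, ?_, ?_, ?_⟩
  · filter_upwards [hφf, hφU] with z hz hzU
    refine κ.injOn ?_ ?_ (sub_eq_zero.1 hz)
    · simpa [κ] using hzU.2.2.1
    · simpa [κ] using hzU.2.2.2
  · filter_upwards [hrel, hφU, hφd] with z hz hzU hzd u
    rw [hm₁ z hzU hzd, hm₁ z hzU hzd, hK₁ _ hzU, hz, h𝒦]
  · filter_upwards [hrel, hφU, hφd] with z hz hzU hzd u
    rw [hm₂ z hzU hzd, hm₂ z hzU hzd, hK₂ _ hzU, hz, h𝒦]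
  · intro X Y hXY
    have hzU := hφU.self_of_nhds
    have hzd := hφd.self_of_nhds
    have h1 : 𝒢.source (a₁ (φ 0)) = 𝒢.target (a₂ (φ 0)) := by rw [hφ0, hbp₁, hbp₂]
    -- Composability of X and Y says that their coordinates form a vector of ker Df, so Dρ supplies
    -- a preimage under Dφ.
    have h2 := hφρ.self_of_nhds (tangentCoord g (a₁ (φ 0)) X, tangentCoord h (a₂ (φ 0)) Y) (by
      rw [hfd _ hzU, tangentCoordSymm_tangentCoord (hsrc₁ _ hzU),
        tangentCoordSymm_tangentCoord (hsrc₂ _ hzU), sub_eq_zero]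
      exact tangentCoord_congr h1 hXY)
    exact ⟨_, (hm₁ 0 hzU hzd _).trans
        ((congrArg (fun w : E × E ↦ tangentCoordSymm g _ w.1) h2).trans
        (tangentCoordSymm_tangentCoord (hsrc₁ _ hzU) X)),
      (hm₂ 0 hzU hzd _).trans ((congrArg (fun w : E × E ↦ tangentCoordSymm h _ w.2) h2).trans
        (tangentCoordSymm_tangentCoord (hsrc₂ _ hzU) Y))⟩

end LieGroupoid

/-! ### The curvature of a projection. -/

namespace VForm

variable {E : Type*} [NormedAddCommGroup E] [NormedSpace ℝ E]
  {N : Type*} [TopologicalSpace N] [ChartedSpace E N] [IsManifold 𝓘(ℝ, E) ∞ N]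

/-- The values of a form at equal points on vectors that agree in the model space agree. -/
theorem toFun_congr {k : ℕ} (K : VForm E N k) {x y : N} (hxy : x = y)
    {v : Fin k → TangentSpace 𝓘(ℝ, E) x} {w : Fin k → TangentSpace 𝓘(ℝ, E) y}
    (hvw : ∀ i, @Eq E (v i) (w i)) : @Eq E (K.toFun x v) (K.toFun y w) := by
  subst hxy
  exact congrArg (K.toFun x) (funext hvw)

variable [FiniteDimensional ℝ E]

/-- The curvature of a projection `K` is `K ∘ N_K`. -/
theorem curvature_eq_endo_nijenhuis (K : VForm E N 1) (hK : K.IsProjection) (x : N)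
    (v : Fin 2 → TangentSpace 𝓘(ℝ, E) x) :
    (K.curvature hK).toFun x v = K.endo x (K.nijenhuis.toFun x v) := by
  obtain ⟨X, hX, hXv⟩ := exists_mdifferentiableAt_eq (v 0)
  obtain ⟨Y, hY, hYv⟩ := exists_mdifferentiableAt_eq (v 1)
  have hv : v = ![X x, Y x] := by ext i; fin_cases i <;> simp [hXv, hYv]
  have hKX := K.mdifferentiableAt_app hX
  have hKY := K.mdifferentiableAt_app hY
  have hP := mdifferentiableAt_sub_section hX hKX
  have hQ := mdifferentiableAt_sub_section hY hKY
  have hKK : ∀ w, K.endo x (K.endo x w) = K.endo x w := fun w ↦ DFunLike.congr_fun (hK x) w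
  -- With P = X - KX and Q = Y - KY, splitting X = P + KX and Y = Q + KY gives [P, Q] = [X, Y] -
  -- [KX, Y] - [X, KY] + [KX, KY]. Applying K yields K N_K(X, Y), because K² = K.
  have e1 := mlieBracket_add_left (W := Y) hP hKX
  have e2 := mlieBracket_add_left (W := K.app Y) hP hKX
  have e3 := mlieBracket_add_right (V := X - K.app X) hQ hKY
  rw [sub_add_cancel] at e1 e2 e3
  rw [hv, K.curvature_apply hK hX hY, K.nijenhuis_apply hX hY]
  simp only [map_add, map_sub, hKK]
  have e1' := congrArg (K.endo x) e1
  have e2' := congrArg (K.endo x) e2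
  have e3' := congrArg (K.endo x) e3
  rw [map_add] at e1' e2' e3'
  linear_combination (norm := module) (-1 : ℝ) • e1' + (1 : ℝ) • e2' - (1 : ℝ) • e3'

end VForm

/-! ### Tangent multiplication and multiplicativity. -/

namespace LieGroupoid

variable {E : Type*} [NormedAddCommGroup E] [NormedSpace ℝ E]
  {G : Type*} [TopologicalSpace G] [ChartedSpace E G]
  {E' : Type*} [NormedAddCommGroup E'] [NormedSpace ℝ E']
  {M : Type*} [TopologicalSpace M] [ChartedSpace E' M]
  {F : Type*} [NormedAddCommGroup F] [NormedSpace ℝ F]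

/-- The derivative of the product of two composable families of arrows. -/
theorem mfderiv_mul (𝒢 : LieGroupoid E G E' M) {φ₁ φ₂ : F → G} {z : F}
    (h₁ : MDifferentiableAt 𝓘(ℝ, F) 𝓘(ℝ, E) φ₁ z) (h₂ : MDifferentiableAt 𝓘(ℝ, F) 𝓘(ℝ, E) φ₂ z)
    (hc : ∀ᶠ y in 𝓝 z, 𝒢.source (φ₁ y) = 𝒢.target (φ₂ y)) (u : F) :
    mfderiv 𝓘(ℝ, F) 𝓘(ℝ, E) (fun y ↦ 𝒢.mul (φ₁ y) (φ₂ y)) z u =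
      𝒢.tangentMul (φ₁ z) (φ₂ z) (mfderiv 𝓘(ℝ, F) 𝓘(ℝ, E) φ₁ z u)
        (mfderiv 𝓘(ℝ, F) 𝓘(ℝ, E) φ₂ z u) := by
  have hm := ((𝒢.smooth_mul (φ₁ z, φ₂ z) hc.self_of_nhds).mdifferentiableWithinAt
    (by simp)).hasMFDerivWithinAt
  have hp := (h₁.hasMFDerivAt.prodMk h₂.hasMFDerivAt).hasMFDerivWithinAt
    (s := {y | 𝒢.source (φ₁ y) = 𝒢.target (φ₂ y)})
  have hs : {y | 𝒢.source (φ₁ y) = 𝒢.target (φ₂ y)} ⊆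
      (fun y ↦ (φ₁ y, φ₂ y)) ⁻¹' 𝒢.composable := fun y hy ↦ hy
  -- The chain rule holds for whichever derivative within `composable` is selected, since the family
  -- stays in that set near z. This makes the choice harmless on velocities of such families.
  have h := (HasMFDerivWithinAt.comp z hm hp hs).hasMFDerivAt hc
  exact congrArg (fun L ↦ L u) h.mfderiv

/-- Multiplication is smooth only within the composable pairs, but a whole neighbourhood of z is
mapped there, so the restriction disappears after composition. -/
theorem contMDiffAt_mul (𝒢 : LieGroupoid E G E' M) {φ₁ φ₂ : F → G} {z : F}
    (h₁ : ContMDiffAt 𝓘(ℝ, F) 𝓘(ℝ, E) ∞ φ₁ z) (h₂ : ContMDiffAt 𝓘(ℝ, F) 𝓘(ℝ, E) ∞ φ₂ z)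
    (hc : ∀ᶠ y in 𝓝 z, 𝒢.source (φ₁ y) = 𝒢.target (φ₂ y)) :
    ContMDiffAt 𝓘(ℝ, F) 𝓘(ℝ, E) ∞ (fun y ↦ 𝒢.mul (φ₁ y) (φ₂ y)) z := by
  have hm := 𝒢.smooth_mul (φ₁ z, φ₂ z) hc.self_of_nhds
  have hp := (h₁.prodMk h₂).contMDiffWithinAt
    (s := {y | 𝒢.source (φ₁ y) = 𝒢.target (φ₂ y)})
  have hs : MapsTo (fun y ↦ (φ₁ y, φ₂ y)) {y | 𝒢.source (φ₁ y) = 𝒢.target (φ₂ y)}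
      {p | 𝒢.source p.1 = 𝒢.target p.2} := fun y hy ↦ hy
  exact (ContMDiffWithinAt.comp z hm hp hs).contMDiffAt hc

/-- The velocities of two composable families of arrows are composable. -/
theorem mfderiv_source_eq_mfderiv_target (𝒢 : LieGroupoid E G E' M) {φ₁ φ₂ : F → G} {z : F}
    (h₁ : MDifferentiableAt 𝓘(ℝ, F) 𝓘(ℝ, E) φ₁ z) (h₂ : MDifferentiableAt 𝓘(ℝ, F) 𝓘(ℝ, E) φ₂ z)
    (hc : ∀ᶠ y in 𝓝 z, 𝒢.source (φ₁ y) = 𝒢.target (φ₂ y)) (u : F) :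
    @Eq E' (mfderiv 𝓘(ℝ, E) 𝓘(ℝ, E') 𝒢.source (φ₁ z) (mfderiv 𝓘(ℝ, F) 𝓘(ℝ, E) φ₁ z u))
      (mfderiv 𝓘(ℝ, E) 𝓘(ℝ, E') 𝒢.target (φ₂ z) (mfderiv 𝓘(ℝ, F) 𝓘(ℝ, E) φ₂ z u)) := by
  have hs := (𝒢.submersion_source.contMDiff (φ₁ z)).mdifferentiableAt (by simp)
  have ht := (𝒢.submersion_target.contMDiff (φ₂ z)).mdifferentiableAt (by simp)
  have e : mfderiv 𝓘(ℝ, F) 𝓘(ℝ, E') (𝒢.source ∘ φ₁) z =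
      mfderiv 𝓘(ℝ, F) 𝓘(ℝ, E') (𝒢.target ∘ φ₂) z :=
    Filter.EventuallyEq.mfderiv_eq hc
  have e1 := mfderiv_comp_apply z hs h₁ u
  have e2 := mfderiv_comp_apply z ht h₂ u
  exact e1.symm.trans ((congrArg (fun L : F →L[ℝ] E' ↦ L u) e).trans e2)

variable [IsManifold 𝓘(ℝ, E) ∞ G] [IsManifold 𝓘(ℝ, E') ∞ M]

/-- A vector-valued form is multiplicative if it is compatible with source, target and
multiplication on tangent vectors. -/
theorem isMultiplicative_of_forall (𝒢 : LieGroupoid E G E' M) {k : ℕ} {K : VForm E G k}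
    {K_M : VForm E' M k}
    (hs : ∀ g (v : Fin k → TangentSpace 𝓘(ℝ, E) g),
      mfderiv 𝓘(ℝ, E) 𝓘(ℝ, E') 𝒢.source g (K.toFun g v) =
        K_M.toFun (𝒢.source g) (fun i ↦ mfderiv 𝓘(ℝ, E) 𝓘(ℝ, E') 𝒢.source g (v i)))
    (ht : ∀ g (v : Fin k → TangentSpace 𝓘(ℝ, E) g),
      mfderiv 𝓘(ℝ, E) 𝓘(ℝ, E') 𝒢.target g (K.toFun g v) =
        K_M.toFun (𝒢.target g) (fun i ↦ mfderiv 𝓘(ℝ, E) 𝓘(ℝ, E') 𝒢.target g (v i)))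
    (hm : ∀ g h (X : Fin k → TangentSpace 𝓘(ℝ, E) g) (Y : Fin k → TangentSpace 𝓘(ℝ, E) h),
      𝒢.source g = 𝒢.target h →
      (∀ i, @Eq E' (mfderiv 𝓘(ℝ, E) 𝓘(ℝ, E') 𝒢.source g (X i))
        (mfderiv 𝓘(ℝ, E) 𝓘(ℝ, E') 𝒢.target h (Y i))) →
      K.toFun (𝒢.mul g h) (fun i ↦ 𝒢.tangentMul g h (X i) (Y i)) =
        𝒢.tangentMul g h (K.toFun g X) (K.toFun h Y)) :
    𝒢.IsMultiplicative K := by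
  refine ⟨K_M, fun a ↦ congrArg (TotalSpace.mk' E' _) (hs a.1 a.2),
    fun a ↦ congrArg (TotalSpace.mk' E' _) (ht a.1 a.2), fun a b hab ↦
    congrArg (TotalSpace.mk' E _) (hm a.1 b.1 a.2 b.2 (congrArg Sigma.fst hab) fun i ↦ ?_)⟩
  -- All tangent spaces of M are E' as types, so the vector component can be read off without
  -- transport along the base point.
  exact congrArg (fun p : Σ x : M, Fin k → TangentSpace 𝓘(ℝ, E') x ↦ (show E' from p.2 i)) hab

/-- The conditions on a multiplicative `1`-form in terms of endomorphisms of tangent spaces. -/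
theorem IsMultiplicative.exists_endo {𝒢 : LieGroupoid E G E' M} {K : VForm E G 1}
    (hK : 𝒢.IsMultiplicative K) :
    ∃ K_M : VForm E' M 1,
      (∀ g (v : TangentSpace 𝓘(ℝ, E) g), mfderiv 𝓘(ℝ, E) 𝓘(ℝ, E') 𝒢.source g (K.endo g v) =
        K_M.endo (𝒢.source g) (mfderiv 𝓘(ℝ, E) 𝓘(ℝ, E') 𝒢.source g v)) ∧
      (∀ g (v : TangentSpace 𝓘(ℝ, E) g), mfderiv 𝓘(ℝ, E) 𝓘(ℝ, E') 𝒢.target g (K.endo g v) =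
        K_M.endo (𝒢.target g) (mfderiv 𝓘(ℝ, E) 𝓘(ℝ, E') 𝒢.target g v)) ∧
      ∀ g h (X : TangentSpace 𝓘(ℝ, E) g) (Y : TangentSpace 𝓘(ℝ, E) h),
        𝒢.source g = 𝒢.target h →
        @Eq E' (mfderiv 𝓘(ℝ, E) 𝓘(ℝ, E') 𝒢.source g X)
          (mfderiv 𝓘(ℝ, E) 𝓘(ℝ, E') 𝒢.target h Y) →
        K.endo (𝒢.mul g h) (𝒢.tangentMul g h X Y) =
          𝒢.tangentMul g h (K.endo g X) (K.endo h Y) := by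
  obtain ⟨K_M, hs, ht, hm⟩ := hK
  refine ⟨K_M, fun g v ↦ ?_, fun g v ↦ ?_, fun g h X Y hgh hXY ↦ ?_⟩
  · exact congrArg (fun p : TangentBundle 𝓘(ℝ, E') M ↦ (show E' from p.2)) (hs ⟨g, fun _ ↦ v⟩)
  · exact congrArg (fun p : TangentBundle 𝓘(ℝ, E') M ↦ (show E' from p.2)) (ht ⟨g, fun _ ↦ v⟩)
  · refine congrArg (fun p : TangentBundle 𝓘(ℝ, E) G ↦ (show E from p.2))
      (hm ⟨g, fun _ ↦ X⟩ ⟨h, fun _ ↦ Y⟩ ?_)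
    have aux : ∀ {x y : M} (_ : x = y) {v : TangentSpace 𝓘(ℝ, E') x} {w : TangentSpace 𝓘(ℝ, E') y},
        @Eq E' v w → (⟨x, fun _ ↦ v⟩ : Σ x : M, Fin 1 → TangentSpace 𝓘(ℝ, E') x) =
          ⟨y, fun _ ↦ w⟩ := by
      rintro x _ rfl v w h
      exact congrArg (fun v : TangentSpace 𝓘(ℝ, E') x ↦
        (⟨x, fun _ ↦ v⟩ : Σ x : M, Fin 1 → TangentSpace 𝓘(ℝ, E') x)) h
    exact aux hgh hXY

variable [FiniteDimensional ℝ E] [FiniteDimensional ℝ E']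

/-- The Nijenhuis tensor of a `1`-form compatible with source, target and multiplication preserves
multiplication. -/
theorem nijenhuis_tangentMul (𝒢 : LieGroupoid E G E' M) {K : VForm E G 1} {K_M : VForm E' M 1}
    (hs : ∀ g (v : TangentSpace 𝓘(ℝ, E) g), mfderiv 𝓘(ℝ, E) 𝓘(ℝ, E') 𝒢.source g (K.endo g v) =
      K_M.endo (𝒢.source g) (mfderiv 𝓘(ℝ, E) 𝓘(ℝ, E') 𝒢.source g v))
    (ht : ∀ g (v : TangentSpace 𝓘(ℝ, E) g), mfderiv 𝓘(ℝ, E) 𝓘(ℝ, E') 𝒢.target g (K.endo g v) =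
      K_M.endo (𝒢.target g) (mfderiv 𝓘(ℝ, E) 𝓘(ℝ, E') 𝒢.target g v))
    (hm : ∀ g h (X : TangentSpace 𝓘(ℝ, E) g) (Y : TangentSpace 𝓘(ℝ, E) h),
      𝒢.source g = 𝒢.target h →
      @Eq E' (mfderiv 𝓘(ℝ, E) 𝓘(ℝ, E') 𝒢.source g X) (mfderiv 𝓘(ℝ, E) 𝓘(ℝ, E') 𝒢.target h Y) →
      K.endo (𝒢.mul g h) (𝒢.tangentMul g h X Y) = 𝒢.tangentMul g h (K.endo g X) (K.endo h Y))
    (g h : G) (X : Fin 2 → TangentSpace 𝓘(ℝ, E) g) (Y : Fin 2 → TangentSpace 𝓘(ℝ, E) h)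
    (hgh : 𝒢.source g = 𝒢.target h)
    (hXY : ∀ i, @Eq E' (mfderiv 𝓘(ℝ, E) 𝓘(ℝ, E') 𝒢.source g (X i))
      (mfderiv 𝓘(ℝ, E) 𝓘(ℝ, E') 𝒢.target h (Y i))) :
    K.nijenhuis.toFun (𝒢.mul g h) (fun i ↦ 𝒢.tangentMul g h (X i) (Y i)) =
      𝒢.tangentMul g h (K.nijenhuis.toFun g X) (K.nijenhuis.toFun h Y) := by
  obtain ⟨S, φ₁, φ₂, A, rfl, rfl, h₁, h₂, hA, hc, hr₁, hr₂, hsurj⟩ :=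
    𝒢.exists_composable_parametrization hs ht hgh
  -- A single vector of S represents the composable pair (X 0, Y 0), and likewise for index 1.
  obtain ⟨a, ha₁, ha₂⟩ := hsurj (X 0) (Y 0) (hXY 0)
  obtain ⟨b, hb₁, hb₂⟩ := hsurj (X 1) (Y 1) (hXY 1)
  have e₁ := K.nijenhuis_map h₁ hA hr₁ a b
  have e₂ := K.nijenhuis_map h₂ hA hr₂ a b
  have hd := (eventually_mdifferentiableAt h₁).and (eventually_mdifferentiableAt h₂)
  have hd₀ := hd.self_of_nhds
  -- By `hm` at every nearby composable pair, the product family relates the same A to K. Thus N_K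
  -- at the product is the tangent multiplication applied to the images of N_A in the two factors.
  have e := K.nijenhuis_map (𝒢.contMDiffAt_mul h₁ h₂ hc) hA (by
    filter_upwards [hd, hc.eventually_nhds, hr₁, hr₂] with z hz hcz hz₁ hz₂ u
    rw [𝒢.mfderiv_mul hz.1 hz.2 hcz, 𝒢.mfderiv_mul hz.1 hz.2 hcz, hz₁, hz₂]
    exact (hm _ _ _ _ hcz.self_of_nhds
      (𝒢.mfderiv_source_eq_mfderiv_target hz.1 hz.2 hcz u)).symm) a b
  rw [𝒢.mfderiv_mul hd₀.1 hd₀.2 hc, 𝒢.mfderiv_mul hd₀.1 hd₀.2 hc, 𝒢.mfderiv_mul hd₀.1 hd₀.2 hc,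
    ← e₁, ← e₂, ha₁, ha₂, hb₁, hb₂] at e
  have hX : X = ![X 0, X 1] := by ext i; fin_cases i <;> rfl
  have hY : Y = ![Y 0, Y 1] := by ext i; fin_cases i <;> rfl
  rw [← hX, ← hY] at e
  rw [← e]
  congr 1
  ext i
  fin_cases i <;> rfl

end LieGroupoid

theorem mainTheorem3
    {E : Type*} [NormedAddCommGroup E] [NormedSpace ℝ E] [FiniteDimensional ℝ E]
    {G : Type*} [TopologicalSpace G] [ChartedSpace E G] [IsManifold 𝓘(ℝ, E) ∞ G]
    {E' : Type*} [NormedAddCommGroup E'] [NormedSpace ℝ E'] [FiniteDimensional ℝ E']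
    {M : Type*} [TopologicalSpace M] [ChartedSpace E' M] [IsManifold 𝓘(ℝ, E') ∞ M]
    (𝒢 : LieGroupoid E G E' M) (K : VForm E G 1) (hK : 𝒢.IsMultiplicative K) :
    𝒢.IsMultiplicative K.nijenhuis ∧
      ∀ hP : K.IsProjection,
        𝒢.IsMultiplicative (K.curvature hP) ∧
          ∀ (g : G) (v : Fin 2 → TangentSpace 𝓘(ℝ, E) g),
            (K.curvature hP).toFun g v = K.endo g (K.nijenhuis.toFun g v) := by
  obtain ⟨K_M, hs, ht, hm⟩ := hK.exists_endo
  have hNs := VForm.nijenhuis_related 𝒢.submersion_source.contMDiff hs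
  have hNt := VForm.nijenhuis_related 𝒢.submersion_target.contMDiff ht
  have hNm := 𝒢.nijenhuis_tangentMul hs ht hm
  refine ⟨𝒢.isMultiplicative_of_forall hNs hNt hNm, fun hP ↦
    ⟨?_, K.curvature_eq_endo_nijenhuis hP⟩⟩
  -- Units make the source surjective, and its derivative is onto, so the identity K ∘ K = K
  -- descends to M.
  have hP_M : K_M.IsProjection := by
    intro x
    obtain ⟨g, rfl⟩ : ∃ g, 𝒢.source g = x := ⟨_, 𝒢.source_one x⟩
    ext w
    obtain ⟨v, rfl⟩ :=
      mfderiv_surjective_of_isSubmersionAt (𝒢.submersion_source.isSubmersionAt g) w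
    rw [ContinuousLinearMap.comp_apply, ← hs, ← hs]
    exact congrArg _ (DFunLike.congr_fun (hP g) v)
  refine 𝒢.isMultiplicative_of_forall (K_M := K_M.curvature hP_M) (fun g v ↦ ?_) (fun g v ↦ ?_)
    fun g h X Y hgh hXY ↦ ?_
  · rw [K.curvature_eq_endo_nijenhuis, K_M.curvature_eq_endo_nijenhuis, hs, hNs]
  · rw [K.curvature_eq_endo_nijenhuis, K_M.curvature_eq_endo_nijenhuis, ht, hNt]
  · rw [K.curvature_eq_endo_nijenhuis, K.curvature_eq_endo_nijenhuis,
      K.curvature_eq_endo_nijenhuis, hNm g h X Y hgh hXY]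
    -- K may be applied to N_K X and N_K Y multiplicatively because these are again composable: both
    -- project to the value of N_{K_M} on the common image of X and Y.
    refine hm g h _ _ hgh ?_
    rw [hNs, hNt]
    exact K_M.nijenhuis.toFun_congr hgh hXY
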